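/- **Setting.** Let $\mathcal Y=[0,1]^d$, let $\mathcal A$ be a finite action set, $\mathcal N$ a finite set of agents, $\mathcal S$ a finite collection of subsequences and $T$ a horizon, with $d|\mathcal A||\mathcal N||\mathcal S|T>1$. Each agent has a utility $u:\mathcal A\times\mathcal Y\to[0,1]$, constraints $c_1,\dots,c_J:\mathcal A\times\mathcal Y\to[-1,1]$ (all measurable in $y$), and a fixed rule for breaking ties. Each $S\in\mathcal S$ is given by an indicator $h_S(t,x)\in\{0,1\}$, measurable in the feature $x$; we write $t\in S$ if $h_S(t,x_t)=1$, and $|S|$ for the number of such rounds $t\in[T]$. In round $t$ an adversary chooses, based on the past, a feature $x_t$ and a distribution of the outcome $y_t\in\mathcal Y$; the forecaster, seeing $x_t$ and the past transcript $\pi^{<t}=((x_s,p_s,y_s))_{s<t}$, draws $p_t\in\mathcal Y$ from a distribution $\psi_t$ (conditionally on $\pi^{<t}$ and $x_t$, the draw is independent of $y_t$); then $y_t$ is revealed. *Agents.* Each agent keeps a set $\widehat{\mathcal A}_{t,S}$ for every $S$, with $\widehat{\mathcal A}_{1,S}=\mathcal A$. After a round $t\in S$ it removes from $\widehat{\mathcal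 A}_{t,S}$ every $a$ with $c_j(a,y_t)>0$ for some $j$; if $t\notin S$ the set is unchanged. With $U_t=\bigcup_{S\ni t}\widehat{\mathcal A}_{t,S}$ it plays $a_t=\mathrm{CBR}^u_{U_t}(p_t)\in\arg\max_{a\in U_t}u(a,p_t)$ (a fixed action if $U_t=\emptyset$). *Unbiased prediction.* For the events $E_{S,u,a}(\pi^{<t},x_t,p)=\mathbf 1[t\in S,\ \mathrm{CBR}^u_{U_t}(p)=a]$ and a rule assigning to each past transcript $\pi^{<t}$ a probability vector $q_t$ (measurable in $\pi^{<t}$) on triples (event $E$, coordinate $i\in[d]$, sign $\sigma$), a forecaster is an $\varepsilon$-accurate instantiation of Unbiased-Prediction if in every round $\psi_t$ minimizes, up to an additive $\varepsilon$, the quantity $$\max_{y\in\mathcal Y}\ \mathbb E_{p\sim\psi}\Big[\sum_{E,i,\sigma}q_t(E,i,\sigma)\,\sigma\,E(\pi^{<t},x_t,p)\,(p^i-y^i)\Big]$$ over all probability distributions $\psi$ on $\mathcal Y$. *Regret.* Let $\mathcal A^{\mathbf c}_S=\{a:c_j(a,y_t)\le0\ \forall t\in S,\ j\in[J]\}$,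 $\mathrm{Reg}_{\rm swap}(u,\mathcal A^{\mathbf c}_S,S)=\max_{\phi:\mathcal A\to\mathcal A^{\mathbf c}_S}\sum_{t\in S}(u(\phi(a_t),y_t)-u(a_t,y_t))$ and $\mathrm{Reg}_{\rm ext}(u,\mathcal A^{\mathbf c}_S,S)=\max_{a\in\mathcal A^{\mathbf c}_S}\sum_{t\in S}(u(a,y_t)-u(a_t,y_t))$. **Theorem.** There is an absolute constant $C>0$ such that for all data as above there is a weight rule $q$, depending only on these data (not on $\delta$ or the adversary), with the following properties. For every $\varepsilon>0$ an $\varepsilon$-accurate instantiation of Unbiased-Prediction with weights $q$ exists. Every $\tfrac1T$-accurate instantiation ("Decision-Calibration-Subsequence") satisfies, against every adaptive adversary and for every $\delta\in(0,1)$, with probability at least $1-\delta$, simultaneously for all agents $(u,\mathbf c)\in\mathcal N$ and all $S\in\mathcal S$: 1. for every $a\in\mathcal A$, with $T^{u,\mathbf c,S}(a)=\sum_{t=1}^T\mathbf 1[t\in S,a_t=a]$, $$\Big\|\sum_{t=1}^T\mathbf 1[t\in S,\,a_t=a](p_t-y_t)\Big\|_\infty\le C\Big(\ln(d|\mathcal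 A||\mathcal N||\mathcal S|T)+\sqrt{\ln(d|\mathcal A||\mathcal N||\mathcal S|T)\,T^{u,\mathbf c,S}(a)}+\sqrt{\ln\tfrac{d|\mathcal A||\mathcal N||\mathcal S|}{\delta}\,|S|}\Big);$$ 2. if $u$ is linear and $L$-Lipschitz (for $\|\cdot\|_\infty$) in its second argument and $\mathcal A^{\mathbf c}_S\ne\emptyset$, then $$\mathrm{Reg}_{\rm swap}(u,\mathcal A^{\mathbf c}_S,S)\le C\,L|\mathcal A|\sqrt{|S|\ln\tfrac{d|\mathcal A||\mathcal N||\mathcal S|T}{\delta}},\qquad \mathrm{Reg}_{\rm ext}(u,\mathcal A^{\mathbf c}_S,S)\le C\,L|\mathcal A|\sqrt{|S|\ln\tfrac{d|\mathcal A||\mathcal N||\mathcal S|T}{\delta}}.$$ -/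

import Mathlib

open MeasureTheory ProbabilityTheory

noncomputable section

/-- The outcome (and prediction) space `[0,1]^d`. -/
abbrev Outcome (d : ℕ) : Type := Set.Icc (0 : Fin d → ℝ) 1

/-- The realized triples (feature, prediction, outcome) of rounds `0, …, t - 1`. -/
abbrev Transcript (X : Type*) (d t : ℕ) : Type _ := Fin t → X × Outcome d × Outcome d

/-- The transcript of the first `t` rounds of given sequences. -/
def transcript {X : Type*} {d : ℕ} (x : ℕ → X) (p y : ℕ → Outcome d) (t : ℕ) :
    Transcript X d t :=
  fun s => (x s, p s, y s)

/-! ### Agents -/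

/-- An agent: a utility function, `J` constraint functions, and the rule by which it breaks ties
between several maximizers. -/
structure Agent (A : Type*) (d J : ℕ) where
  utility : A → Outcome d → ℝ
  utility_mem : ∀ a y, utility a y ∈ Set.Icc (0 : ℝ) 1
  measurable_utility : ∀ a, Measurable (utility a)
  constraint : Fin J → A → Outcome d → ℝ
  constraint_mem : ∀ j a y, constraint j a y ∈ Set.Icc (-1 : ℝ) 1
  measurable_constraint : ∀ j a, Measurable (constraint j a)
  tie : Finset A → A
  tie_mem : ∀ s : Finset A, s.Nonempty → tie s ∈ s

namespace Agent

variable {A : Type*} {d J : ℕ}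

/-- `u(a, k₁ y₁ + k₂ y₂) = k₁ u(a, y₁) + k₂ u(a, y₂)` whenever all three points are outcomes. -/
def IsLinear (ag : Agent A d J) : Prop :=
  ∀ (a : A) (k₁ k₂ : ℝ) (y₁ y₂ y : Outcome d),
    (y : Fin d → ℝ) = k₁ • (y₁ : Fin d → ℝ) + k₂ • (y₂ : Fin d → ℝ) →
      ag.utility a y = k₁ * ag.utility a y₁ + k₂ * ag.utility a y₂

/-- The utility is `L`-Lipschitz in the outcome for the sup norm. -/
def IsLipschitz (ag : Agent A d J) (L : ℝ) : Prop :=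
  ∀ (a : A) (y₁ y₂ : Outcome d),
    |ag.utility a y₁ - ag.utility a y₂| ≤ L * ‖(y₁ : Fin d → ℝ) - (y₂ : Fin d → ℝ)‖

open Classical in
/-- The `U`-constrained best response to `p`: a maximizer of `u(·, p)` over `U`, ties being broken
by the agent's rule. (If `U = ∅`, the fixed action `tie ∅`.) -/
def cbr (ag : Agent A d J) (U : Finset A) (p : Outcome d) : A :=
  ag.tie (U.filter fun a => ∀ b ∈ U, ag.utility b p ≤ ag.utility a p)

variable {X κ : Type*}

open Classical in
/-- The candidate action set for the subsequence `S` after the transcript `π`. The indicator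
`h S t x` says whether round `t` with feature `x` belongs to `S`. -/
def candidates [Fintype A] (ag : Agent A d J) (h : κ → ℕ → X → Bool) (S : κ) :
    (t : ℕ) → Transcript X d t → Finset A
  | 0, _ => Finset.univ
  | t + 1, π =>
    let prev := ag.candidates h S t (Fin.init π)
    if h S t (π (Fin.last t)).1 = true then
      prev \ prev.filter (fun a => ∃ j, 0 < ag.constraint j a (π (Fin.last t)).2.2)
    else prev

open Classical in
/-- `U_t`: the union of the candidate sets over the subsequences that are active in round `t`. -/
def unionSet [Fintype A] [Fintype κ] (ag : Agent A d J) (h : κ → ℕ → X → Bool) (t : ℕ)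
    (π : Transcript X d t) (x : X) : Finset A :=
  (Finset.univ.filter fun S : κ => h S t x = true).biUnion fun S => ag.candidates h S t π

/-- The action `CBR_{U_t}(p)` that the elimination-based agent plays in round `t`. -/
def action [Fintype A] [Fintype κ] (ag : Agent A d J) (h : κ → ℕ → X → Bool) (t : ℕ)
    (π : Transcript X d t) (x : X) (p : Outcome d) : A :=
  ag.cbr (ag.unionSet h t π x) p

/-- The action played in round `t` along given sequences. -/
def played [Fintype A] [Fintype κ] (ag : Agent A d J) (h : κ → ℕ → X → Bool)
    (x : ℕ → X) (p y : ℕ → Outcome d) (t : ℕ) : A :=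
  ag.action h t (transcript x p y t) (x t) (p t)

/-- The benchmark class: actions that satisfy all constraints in every round of `R`. -/
def benchmark (ag : Agent A d J) (R : Finset ℕ) (y : ℕ → Outcome d) : Set A :=
  {a | ∀ t ∈ R, ∀ j, ag.constraint j a (y t) ≤ 0}

/-- External regret of the action sequence `act` against the class `B` over the rounds `R`. -/
def extRegret (ag : Agent A d J) (B : Set A) (R : Finset ℕ) (act : ℕ → A)
    (y : ℕ → Outcome d) : ℝ :=
  ⨆ a : B, ∑ t ∈ R, (ag.utility a (y t) - ag.utility (act t) (y t))

/-- Swap regret of the action sequence `act` against the class `B` over the rounds `R`. -/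
def swapRegret (ag : Agent A d J) (B : Set A) (R : Finset ℕ) (act : ℕ → A)
    (y : ℕ → Outcome d) : ℝ :=
  ⨆ φ : A → B, ∑ t ∈ R, (ag.utility (φ (act t)) (y t) - ag.utility (act t) (y t))

end Agent

/-- The rounds among the first `T` that belong to the subsequence `S`. -/
def rounds {X κ : Type*} (h : κ → ℕ → X → Bool) (T : ℕ) (S : κ) (x : ℕ → X) : Finset ℕ :=
  (Finset.range T).filter fun t => h S t (x t) = true

open Classical in
/-- The rounds of `R` in which the action `a` is played. -/
def roundsPlaying {A : Type*} (R : Finset ℕ) (act : ℕ → A) (a : A) : Finset ℕ :=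
  R.filter fun t => act t = a

/-! ### The forecaster -/

/-- An event: a function of the past transcript, the current feature and the current
prediction. -/
abbrev Event (X : Type*) (d : ℕ) : Type _ :=
  (t : ℕ) → Transcript X d t → X → Outcome d → ℝ

open Classical in
/-- The event `1[t ∈ S, CBR_{U_t}(p) = a]`, for a subsequence `S`, an agent and an action `a`. -/
def decisionEvent {X A κ ι : Type*} [Fintype A] [Fintype κ] {d J : ℕ}
    (agent : ι → Agent A d J) (h : κ → ℕ → X → Bool) (e : κ × ι × A) : Event X d :=
  fun t π x p => if h e.1 t x = true ∧ (agent e.2.1).action h t π x p = e.2.2 then 1 else 0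

/-- A rule assigning to every past transcript a probability vector on the triples
(event, coordinate, sign). -/
structure WeightRule (X : Type*) [MeasurableSpace X] (d : ℕ) (E : Type*) [Fintype E] where
  weight : (t : ℕ) → Transcript X d t → E × Fin d × ℤˣ → ℝ
  measurable_weight : ∀ t z, Measurable fun π => weight t π z
  weight_nonneg : ∀ t π z, 0 ≤ weight t π z
  sum_weight : ∀ t π, ∑ z, weight t π z = 1

/-- A randomized forecaster: in round `t` the prediction is drawn from `law t (π, x)`, where `π` is
the past transcript and `x` the current feature. -/
structure Forecaster (X : Type*) [MeasurableSpace X] (d : ℕ) where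
  law : (t : ℕ) → Kernel (Transcript X d t × X) (Outcome d)
  isMarkovKernel_law : ∀ t, IsMarkovKernel (law t)

section UnbiasedPrediction

variable {X : Type*} [MeasurableSpace X] {d : ℕ} {E : Type*} [Fintype E]

/-- The payoff
`𝔼_{p ∼ ψ} [∑_{e, i, σ} q_t(e, i, σ) · σ · e(π, x, p) · (p^i - y^i)]` of the round-`t` minmax
problem. -/
def minmaxPayoff (ev : E → Event X d) (q : WeightRule X d E) (t : ℕ) (π : Transcript X d t)
    (x : X) (ψ : Measure (Outcome d)) (y : Outcome d) : ℝ :=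
  ∫ p, ∑ z : E × Fin d × ℤˣ, q.weight t π z * ((z.2.2 : ℤ) : ℝ) * ev z.1 t π x p *
    ((p : Fin d → ℝ) z.2.1 - (y : Fin d → ℝ) z.2.1) ∂ψ

/-- `F` runs the unbiased-prediction scheme for the events `ev` with weights `q` over `T` rounds:
in every round its law minimizes, up to `ε`, the worst-case payoff `max_y` of the minmax
problem over all probability distributions on predictions. -/
def IsUnbiasedPrediction (T : ℕ) (ev : E → Event X d) (q : WeightRule X d E) (ε : ℝ)
    (F : Forecaster X d) : Prop :=
  ∀ t < T, ∀ (π : Transcript X d t) (x : X) (ψ : ProbabilityMeasure (Outcome d)),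
    (⨆ y, minmaxPayoff ev q t π x (F.law t (π, x)) y) ≤
      (⨆ y, minmaxPayoff ev q t π x (ψ : Measure (Outcome d)) y) + ε

/-- The random sequences `x, p, y` arise from `T` rounds of play of the forecaster `F` against an
adaptive adversary: in each round, given the past transcript, the current feature and the current
outcome, the prediction has the law prescribed by `F` (which sees the past and the feature only).
The conditional laws of features and outcomes given the past are unrestricted. -/
structure IsPlay (F : Forecaster X d) (T : ℕ) {Ω : Type*} [MeasurableSpace Ω] (P : Measure Ω)
    (x : ℕ → Ω → X) (p y : ℕ → Ω → Outcome d) : Prop where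
  measurable_feature : ∀ t < T, Measurable (x t)
  measurable_prediction : ∀ t < T, Measurable (p t)
  measurable_outcome : ∀ t < T, Measurable (y t)
  hasCondDistrib : ∀ t < T,
    HasCondDistrib (p t)
      (fun ω => ((transcript (fun s => x s ω) (fun s => p s ω) (fun s => y s ω) t, x t ω), y t ω))
      (Kernel.prodMkRight (Outcome d) (F.law t)) P

end UnbiasedPrediction

end

/-! The argument is a betting one. For each triple `z = (event, coordinate, sign)` and each learning
rate `η` among `1/2, …, 1/(T+1)`, a gambler bets the fraction `η` of its wealth that the signed bias
of `z` is positive. The rule `stakeWeights` weights `z` in proportion to the total amount staked on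
it, so the increment of the total wealth in a round is the total stake times the minmax integrand of
that round (`totalWealth_succ`, `sum_stake_mul_gain`).

The minmax value is at most zero: against a known outcome, predicting that outcome makes every gain
vanish, and Sion's theorem exchanges the quantifiers (`exists_mixed_prediction`). Hence with a
`1/T`-accurate forecaster the expected total wealth grows by at most the factor `1 + 1/T` per round,
and by at most `e` overall. Markov's inequality (`IsPlay.exists_totalWealth_le`) bounds the final
wealth for all triples and rates at once; `δ` enters only here, so the weights do not depend on it.

Each single wealth is at least `exp (η · bias - 2η² · n)`, where `n` is the accumulated value of the
event (`exp_le_wealth`). Taking logarithms and choosing the rate afterwards, of order `√(Λ/n)`,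
gives a bias bound that adapts to the number `n` of rounds in which the action is played.

For regret, elimination never discards a benchmark action, so the played action is optimal at the
prediction among all of them. Linearity turns the error of replacing outcomes by predictions, on the
rounds where a fixed action is played, into `L` times the bias (`abs_sum_utility_sub_le`). Summing
over actions gives swap regret; external regret is the case of constant swaps. -/

/-! ### Multiplicative wealth and the weight rule -/

section Wealth

variable {X : Type*} [MeasurableSpace X] {d : ℕ} {E : Type*}

/-- The signed bias `σ · e(π, x, p) · (p^i - y^i)` of the triple `z = (e, i, σ)`. -/
noncomputable def gain (ev : E → Event X d) (t : ℕ) (π : Transcript X d t) (x : X)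
    (p y : Outcome d) (z : E × Fin d × ℤˣ) : ℝ :=
  ((z.2.2 : ℤ) : ℝ) * ev z.1 t π x p * ((p : Fin d → ℝ) z.2.1 - (y : Fin d → ℝ) z.2.1)

/-- The wealth `∏ (1 + η · gain)` accumulated along a transcript at the learning rate `η`. -/
noncomputable def wealth (ev : E → Event X d) (η : ℝ) (z : E × Fin d × ℤˣ) :
    (t : ℕ) → Transcript X d t → ℝ
  | 0, _ => 1
  | t + 1, π => wealth ev η z t (Fin.init π) *
      (1 + η * gain ev t (Fin.init π) (π (Fin.last t)).1 (π (Fin.last t)).2.1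
        (π (Fin.last t)).2.2 z)

/-- The learning rates `1/2, 1/3, …`. -/
noncomputable def rate (j : ℕ) : ℝ := 1 / ((j : ℝ) + 2)

lemma rate_pos (j : ℕ) : 0 < rate j := by unfold rate; positivity

lemma rate_le_half (j : ℕ) : rate j ≤ 1 / 2 := by
  unfold rate
  exact one_div_le_one_div_of_le (by norm_num) (by linarith [(Nat.cast_nonneg j : (0 : ℝ) ≤ j)])

/-- Events with values in `[0, 1]` that are jointly measurable. -/
structure IsMeasurableEvents (ev : E → Event X d) : Prop where
  mem_Icc : ∀ e t π x p, ev e t π x p ∈ Set.Icc (0 : ℝ) 1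
  measurable : ∀ e t, Measurable fun a : (Transcript X d t × X) × Outcome d =>
    ev e t a.1.1 a.1.2 a.2

lemma Outcome.abs_sub_le_one (p y : Outcome d) (i : Fin d) :
    |(p : Fin d → ℝ) i - (y : Fin d → ℝ) i| ≤ 1 := by
  have h1 := p.2.1 i
  have h2 := p.2.2 i
  have h3 := y.2.1 i
  have h4 := y.2.2 i
  simp only [Pi.zero_apply, Pi.one_apply] at h1 h2 h3 h4
  rw [abs_le]
  constructor <;> linarith

lemma abs_units_cast (σ : ℤˣ) : |((σ : ℤ) : ℝ)| = 1 := by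
  rcases Int.units_eq_one_or σ with rfl | rfl <;> simp

lemma measurable_coord (i : Fin d) : Measurable fun p : Outcome d => (p : Fin d → ℝ) i :=
  (measurable_pi_apply i).comp measurable_subtype_coe

variable {ev : E → Event X d}

omit [MeasurableSpace X] in
lemma abs_gain_le_event {t : ℕ} {π : Transcript X d t} {x : X} {p y : Outcome d}
    {z : E × Fin d × ℤˣ} (h : 0 ≤ ev z.1 t π x p) :
    |gain ev t π x p y z| ≤ ev z.1 t π x p := by
  unfold gain
  rw [abs_mul, abs_mul, abs_units_cast, one_mul, abs_of_nonneg h]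
  exact mul_le_of_le_one_right h (p.abs_sub_le_one y _)

lemma IsMeasurableEvents.abs_gain_le_one (hev : IsMeasurableEvents ev) (t : ℕ)
    (π : Transcript X d t) (x : X) (p y : Outcome d) (z : E × Fin d × ℤˣ) :
    |gain ev t π x p y z| ≤ 1 :=
  (abs_gain_le_event (hev.mem_Icc _ _ _ _ _).1).trans (hev.mem_Icc _ _ _ _ _).2

lemma IsMeasurableEvents.measurable_gain (hev : IsMeasurableEvents ev) (t : ℕ)
    (z : E × Fin d × ℤˣ) :
    Measurable fun a : ((Transcript X d t × X) × Outcome d) × Outcome d =>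
      gain ev t a.1.1.1 a.1.1.2 a.2 a.1.2 z := by
  unfold gain
  have h1 : Measurable fun a : ((Transcript X d t × X) × Outcome d) × Outcome d =>
      ev z.1 t a.1.1.1 a.1.1.2 a.2 :=
    (hev.measurable z.1 t).comp (measurable_fst.fst.prodMk measurable_snd)
  exact (h1.const_mul _).mul
    (((measurable_coord z.2.1).comp measurable_snd).sub
      ((measurable_coord z.2.1).comp measurable_fst.snd))

lemma IsMeasurableEvents.factor_bounds (hev : IsMeasurableEvents ev) {η : ℝ} (h0 : 0 ≤ η)
    (h1 : η ≤ 1 / 2) (t : ℕ) (π : Transcript X d t) (x : X) (p y : Outcome d)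
    (z : E × Fin d × ℤˣ) :
    1 / 2 ≤ 1 + η * gain ev t π x p y z ∧ 1 + η * gain ev t π x p y z ≤ 2 := by
  have h := hev.abs_gain_le_one t π x p y z
  have : |η * gain ev t π x p y z| ≤ 1 / 2 := by
    rw [abs_mul, abs_of_nonneg h0]
    nlinarith [abs_nonneg (gain ev t π x p y z)]
  rw [abs_le] at this
  constructor <;> linarith

lemma IsMeasurableEvents.wealth_pos (hev : IsMeasurableEvents ev) {η : ℝ} (h0 : 0 ≤ η)
    (h1 : η ≤ 1 / 2) (z : E × Fin d × ℤˣ) (t : ℕ) (π : Transcript X d t) :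
    0 < wealth ev η z t π := by
  induction t with
  | zero => simp [wealth]
  | succ t ih =>
    rw [wealth]
    exact mul_pos (ih _) (by linarith [(hev.factor_bounds h0 h1 t (Fin.init π) (π (Fin.last t)).1
      (π (Fin.last t)).2.1 (π (Fin.last t)).2.2 z).1])

/-- This crude bound serves only for integrability. -/
lemma IsMeasurableEvents.wealth_le (hev : IsMeasurableEvents ev) {η : ℝ} (h0 : 0 ≤ η)
    (h1 : η ≤ 1 / 2) (z : E × Fin d × ℤˣ) (t : ℕ) (π : Transcript X d t) :
    wealth ev η z t π ≤ 2 ^ t := by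
  induction t with
  | zero => simp [wealth]
  | succ t ih =>
    have h := hev.factor_bounds h0 h1 t (Fin.init π) (π (Fin.last t)).1
      (π (Fin.last t)).2.1 (π (Fin.last t)).2.2 z
    rw [wealth, pow_succ]
    exact mul_le_mul (ih _) h.2 (by linarith [h.1]) (by positivity)

lemma measurable_transcript_init (t : ℕ) :
    Measurable fun π : Transcript X d (t + 1) => (Fin.init π : Transcript X d t) :=
  measurable_pi_lambda _ fun s => measurable_pi_apply (Fin.castSucc s)

lemma IsMeasurableEvents.measurable_wealth (hev : IsMeasurableEvents ev) (η : ℝ)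
    (z : E × Fin d × ℤˣ) (t : ℕ) : Measurable (wealth ev η z t) := by
  induction t with
  | zero => simp only [wealth]; exact measurable_const
  | succ t ih =>
    simp only [wealth]
    have hl : Measurable fun π : Transcript X d (t + 1) => π (Fin.last t) := measurable_pi_apply _
    have hi := measurable_transcript_init (X := X) (d := d) t
    refine (ih.comp hi).mul (measurable_const.add (Measurable.const_mul ?_ _))
    exact (hev.measurable_gain t z).comp
      (((hi.prodMk hl.fst).prodMk hl.snd.snd).prodMk hl.snd.fst)

/-- The stake `∑ η · wealth` placed on the triple `z`. -/
noncomputable def stake (ev : E → Event X d) (n t : ℕ) (π : Transcript X d t)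
    (z : E × Fin d × ℤˣ) : ℝ :=
  ∑ j ∈ Finset.range n, rate j * wealth ev (rate j) z t π

lemma IsMeasurableEvents.stake_nonneg (hev : IsMeasurableEvents ev) (n t : ℕ)
    (π : Transcript X d t) (z : E × Fin d × ℤˣ) : 0 ≤ stake ev n t π z :=
  Finset.sum_nonneg fun j _ =>
    mul_nonneg (rate_pos j).le (hev.wealth_pos (rate_pos j).le (rate_le_half j) z t π).le

lemma IsMeasurableEvents.stake_pos (hev : IsMeasurableEvents ev) {n : ℕ} (hn : 0 < n) (t : ℕ)
    (π : Transcript X d t) (z : E × Fin d × ℤˣ) : 0 < stake ev n t π z :=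
  Finset.sum_pos (fun j _ =>
    mul_pos (rate_pos j) (hev.wealth_pos (rate_pos j).le (rate_le_half j) z t π))
    ⟨0, Finset.mem_range.2 hn⟩

lemma IsMeasurableEvents.measurable_stake (hev : IsMeasurableEvents ev) (n t : ℕ)
    (z : E × Fin d × ℤˣ) : Measurable fun π => stake ev n t π z :=
  Finset.measurable_fun_sum _ fun j _ => (hev.measurable_wealth (rate j) z t).const_mul _

variable [Fintype E]

/-- The total wealth over all triples and the first `n` learning rates. -/
noncomputable def totalWealth (ev : E → Event X d) (n t : ℕ) (π : Transcript X d t) : ℝ :=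
  ∑ z : E × Fin d × ℤˣ, ∑ j ∈ Finset.range n, wealth ev (rate j) z t π

lemma IsMeasurableEvents.totalWealth_nonneg (hev : IsMeasurableEvents ev) (n t : ℕ)
    (π : Transcript X d t) : 0 ≤ totalWealth ev n t π :=
  Finset.sum_nonneg fun z _ => Finset.sum_nonneg fun j _ =>
    (hev.wealth_pos (rate_pos j).le (rate_le_half j) z t π).le

/-- Rates are at most one. This lets an error `ε` per unit of stake be charged as `ε` per unit of
wealth. -/
lemma IsMeasurableEvents.sum_stake_le (hev : IsMeasurableEvents ev) (n t : ℕ)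
    (π : Transcript X d t) : ∑ z, stake ev n t π z ≤ totalWealth ev n t π := by
  refine Finset.sum_le_sum fun z _ => Finset.sum_le_sum fun j _ => ?_
  exact mul_le_of_le_one_left (hev.wealth_pos (rate_pos j).le (rate_le_half j) z t π).le
    ((rate_le_half j).trans (by norm_num))

lemma IsMeasurableEvents.totalWealth_le (hev : IsMeasurableEvents ev) (n t : ℕ)
    (π : Transcript X d t) :
    totalWealth ev n t π ≤ Fintype.card (E × Fin d × ℤˣ) * (n * 2 ^ t) := by
  calc totalWealth ev n t π
      ≤ ∑ _z : E × Fin d × ℤˣ, ∑ _j ∈ Finset.range n, (2 : ℝ) ^ t :=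
        Finset.sum_le_sum fun z _ => Finset.sum_le_sum fun j _ =>
          hev.wealth_le (rate_pos j).le (rate_le_half j) z t π
    _ = _ := by simp

lemma IsMeasurableEvents.measurable_totalWealth (hev : IsMeasurableEvents ev) (n t : ℕ) :
    Measurable (totalWealth ev n t) :=
  Finset.measurable_fun_sum _ fun z _ => Finset.measurable_fun_sum _ fun j _ =>
    hev.measurable_wealth (rate j) z t

omit [MeasurableSpace X] in
lemma totalWealth_zero (n : ℕ) (π : Transcript X d 0) :
    totalWealth ev n 0 π = Fintype.card (E × Fin d × ℤˣ) * n := by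
  simp [totalWealth, wealth]

omit [MeasurableSpace X] in
-- Each wealth grows by its rate times itself times a gain that does not depend on the rate, so the
-- rates collapse into one stake per triple.
lemma totalWealth_succ (n t : ℕ) (π : Transcript X d (t + 1)) :
    totalWealth ev n (t + 1) π = totalWealth ev n t (Fin.init π) +
      ∑ z, stake ev n t (Fin.init π) z * gain ev t (Fin.init π) (π (Fin.last t)).1
        (π (Fin.last t)).2.1 (π (Fin.last t)).2.2 z := by
  simp only [totalWealth, stake, wealth, ← Finset.sum_add_distrib, Finset.sum_mul]
  refine Finset.sum_congr rfl fun z _ => Finset.sum_congr rfl fun j _ => ?_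
  ring

/-- The weights proportional to the stakes. -/
noncomputable def stakeWeights [Nonempty (E × Fin d × ℤˣ)] (hev : IsMeasurableEvents ev) {n : ℕ}
    (hn : 0 < n) : WeightRule X d E where
  weight t π z := stake ev n t π z / ∑ z', stake ev n t π z'
  measurable_weight t z := (hev.measurable_stake n t z).div
    (Finset.measurable_fun_sum _ fun z' _ => hev.measurable_stake n t z')
  weight_nonneg t π z := div_nonneg (hev.stake_nonneg n t π z)
    (Finset.sum_nonneg fun z' _ => hev.stake_nonneg n t π z')
  sum_weight t π := by
    rw [← Finset.sum_div]
    exact div_self (Finset.sum_pos (fun z _ => hev.stake_pos hn t π z)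
      Finset.univ_nonempty).ne'

lemma IsMeasurableEvents.sum_stake_mul_gain [Nonempty (E × Fin d × ℤˣ)]
    (hev : IsMeasurableEvents ev) {n : ℕ} (hn : 0 < n) (t : ℕ) (π : Transcript X d t) (x : X)
    (p y : Outcome d) :
    ∑ z, stake ev n t π z * gain ev t π x p y z =
      (∑ z, stake ev n t π z) *
        ∑ z, (stakeWeights hev hn).weight t π z * gain ev t π x p y z := by
  have h : (∑ z, stake ev n t π z) ≠ 0 :=
    (Finset.sum_pos (fun z _ => hev.stake_pos hn t π z) Finset.univ_nonempty).ne'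
  rw [Finset.mul_sum]
  refine Finset.sum_congr rfl fun z _ => ?_
  simp only [stakeWeights]
  field_simp

lemma minmaxPayoff_eq (q : WeightRule X d E) (t : ℕ) (π : Transcript X d t) (x : X)
    (ψ : Measure (Outcome d)) (y : Outcome d) :
    minmaxPayoff ev q t π x ψ y = ∫ p, ∑ z, q.weight t π z * gain ev t π x p y z ∂ψ := by
  unfold minmaxPayoff gain
  simp only [mul_assoc]

lemma WeightRule.abs_sum_weight_mul_gain_le (q : WeightRule X d E) (hev : IsMeasurableEvents ev)
    (t : ℕ) (π : Transcript X d t) (x : X) (p y : Outcome d) :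
    |∑ z, q.weight t π z * gain ev t π x p y z| ≤ 1 := by
  calc _ ≤ ∑ z, |q.weight t π z * gain ev t π x p y z| := Finset.abs_sum_le_sum_abs _ _
    _ ≤ ∑ z, q.weight t π z := Finset.sum_le_sum fun z _ => by
        rw [abs_mul, abs_of_nonneg (q.weight_nonneg t π z)]
        exact mul_le_of_le_one_right (q.weight_nonneg t π z) (hev.abs_gain_le_one ..)
    _ = 1 := q.sum_weight t π

lemma abs_minmaxPayoff_le (q : WeightRule X d E) (hev : IsMeasurableEvents ev)
    (t : ℕ) (π : Transcript X d t) (x : X) (ψ : Measure (Outcome d)) [IsProbabilityMeasure ψ]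
    (y : Outcome d) : |minmaxPayoff ev q t π x ψ y| ≤ 1 := by
  rw [minmaxPayoff_eq]
  have := norm_integral_le_of_norm_le_const (μ := ψ) (C := 1)
    (f := fun p => ∑ z, q.weight t π z * gain ev t π x p y z)
    (Filter.Eventually.of_forall fun p => q.abs_sum_weight_mul_gain_le hev t π x p y)
  simpa using this

lemma bddAbove_minmaxPayoff (q : WeightRule X d E) (hev : IsMeasurableEvents ev)
    (t : ℕ) (π : Transcript X d t) (x : X) (ψ : Measure (Outcome d)) [IsProbabilityMeasure ψ] :
    BddAbove (Set.range fun y => minmaxPayoff ev q t π x ψ y) :=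
  ⟨1, by rintro _ ⟨y, rfl⟩; exact (abs_le.1 (abs_minmaxPayoff_le q hev t π x ψ y)).2⟩

end Wealth

/-! ### The minmax problem of a round -/

section Minmax

variable {X : Type*} [MeasurableSpace X] {d : ℕ} {E : Type*} [Fintype E] {ev : E → Event X d}

lemma exists_finset_net (d : ℕ) {ε : ℝ} (hε : 0 < ε) :
    ∃ s : Finset (Outcome d), ∀ y : Fin d → ℝ, y ∈ Set.Icc (0 : Fin d → ℝ) 1 →
      ∃ p ∈ s, ∀ i, |(p : Fin d → ℝ) i - y i| ≤ ε := by
  obtain ⟨t, ht, hcov⟩ := Metric.totallyBounded_iff.1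
    (isCompact_univ (X := Outcome d)).totallyBounded ε hε
  refine ⟨ht.toFinset, fun y hy => ?_⟩
  obtain ⟨p, hp, hyp⟩ := Set.mem_iUnion₂.1 (hcov (Set.mem_univ (⟨y, hy⟩ : Outcome d)))
  refine ⟨p, ht.mem_toFinset.2 hp, fun i => ?_⟩
  have h := (dist_le_pi_dist ((p : Fin d → ℝ)) y i).trans
    ((dist_comm (p : Fin d → ℝ) y).trans_lt hyp).le
  simpa [Real.dist_eq] using h

/-- A function of a prediction and an outcome that is affine in the outcome and small whenever
prediction and outcome are close has a mixed prediction that is good against all outcomes. -/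
lemma exists_mixed_prediction {Z : Type*} [Fintype Z] (w : Z → Outcome d → ℝ) (i : Z → Fin d)
    (hw : ∀ p, ∑ z, |w z p| ≤ 1) {ε : ℝ} (hε : 0 < ε) :
    ∃ (s : Finset (Outcome d)) (a : s → ℝ), a ∈ stdSimplex ℝ s ∧ ∀ y : Outcome d,
      ∑ p, a p * ∑ z, w z p * ((p : Outcome d).1 (i z) - y.1 (i z)) ≤ ε := by
  classical
  -- Events are discontinuous in the prediction. Mixing over a finite net makes the payoff linear,
  -- hence continuous, in the mixing weights.
  obtain ⟨s, hs⟩ := exists_finset_net d hε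
  obtain ⟨p₀, hp₀, -⟩ := hs 0 ⟨le_rfl, zero_le_one⟩
  let F : (s → ℝ) → (Fin d → ℝ) → ℝ := fun a y =>
    ∑ p, a p * ∑ z, w z p * ((p : Outcome d).1 (i z) - y (i z))
  have hF1 (y) : Continuous fun a => F a y := by fun_prop
  have hF2 (a) : Continuous (F a) := by fun_prop
  obtain ⟨a, ha, b, hb, hab⟩ := Sion.exists_isSaddlePointOn (X := stdSimplex ℝ s)
    (Y := Set.Icc (0 : Fin d → ℝ) 1) (f := F) ⟨_, single_mem_stdSimplex ℝ ⟨p₀, hp₀⟩⟩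
    (convex_stdSimplex ℝ s) (isCompact_stdSimplex ℝ s)
    (fun y _ => (hF1 y).lowerSemicontinuous.lowerSemicontinuousOn _)
    (fun y _ => ConvexOn.quasiconvexOn ⟨convex_stdSimplex ℝ s, fun a₁ _ a₂ _ k₁ k₂ _ _ _ => by
      simp only [F, Pi.add_apply, Pi.smul_apply, smul_eq_mul, add_mul, Finset.sum_add_distrib,
        mul_assoc, ← Finset.mul_sum]
      exact le_rfl⟩)
    (convex_Icc _ _) ⟨0, le_rfl, zero_le_one⟩ isCompact_Icc
    (fun a _ => (hF2 a).upperSemicontinuous.upperSemicontinuousOn _)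
    (fun a _ => ConcaveOn.quasiconcaveOn ⟨convex_Icc _ _, fun y₁ _ y₂ _ k₁ k₂ _ _ hk => by
      simp only [F, Pi.add_apply, Pi.smul_apply, smul_eq_mul, Finset.mul_sum,
        ← Finset.sum_add_distrib]
      refine le_of_eq (Finset.sum_congr rfl fun p _ => Finset.sum_congr rfl fun z _ => ?_)
      -- The payoff is affine rather than linear in `y`, so `k₁ + k₂ = 1` is needed.
      rw [← eq_sub_iff_add_eq'] at hk
      subst hk
      ring⟩)
  refine ⟨s, a, ha, fun y => ?_⟩
  -- Against the saddle outcome `b`, the point mass at a net point near `b` pays at most `ε`; the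
  -- saddle inequality transfers this to `a` against every `y`.
  obtain ⟨p, hp, hpb⟩ := hs b hb
  refine (hab _ (single_mem_stdSimplex ℝ ⟨p, hp⟩) y.1 y.2).trans ?_
  have : F (Pi.single ⟨p, hp⟩ 1) b = ∑ z, w z p * (p.1 (i z) - b (i z)) := by
    simp only [F]
    rw [Finset.sum_eq_single (⟨p, hp⟩ : s) (fun q _ hq => by simp [hq]) (by simp)]
    simp
  rw [this]
  calc ∑ z, w z p * (p.1 (i z) - b (i z)) ≤ ∑ z, |w z p| * ε :=
        Finset.sum_le_sum fun z _ => (le_abs_self _).trans (by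
          rw [abs_mul]; exact mul_le_mul_of_nonneg_left (hpb _) (abs_nonneg _))
    _ ≤ ε := by rw [← Finset.sum_mul]; exact mul_le_of_le_one_left hε.le (hw p)

/-- The mixture of point masses with the given weights. -/
noncomputable def mixture (s : Finset (Outcome d)) (a : s → ℝ) : Measure (Outcome d) :=
  ∑ p : s, ENNReal.ofReal (a p) • Measure.dirac (p : Outcome d)

lemma isProbabilityMeasure_mixture {s : Finset (Outcome d)} {a : s → ℝ}
    (ha : a ∈ stdSimplex ℝ s) : IsProbabilityMeasure (mixture s a) := by
  constructor
  simp only [mixture, Measure.coe_finsetSum, Finset.sum_apply, Measure.smul_apply, measure_univ,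
    smul_eq_mul, mul_one]
  rw [← ENNReal.ofReal_sum_of_nonneg fun p _ => ha.1 p, ha.2, ENNReal.ofReal_one]

lemma integral_mixture {s : Finset (Outcome d)} {a : s → ℝ} (ha : a ∈ stdSimplex ℝ s)
    (f : Outcome d → ℝ) :
    ∫ p, f p ∂(mixture s a) = ∑ p, a p * f p := by
  rw [mixture, integral_finsetSum_measure fun p _ => ?_]
  · simp [integral_smul_measure, integral_dirac, ENNReal.toReal_ofReal (ha.1 _)]
  · exact (integrable_dirac (by simp)).smul_measure ENNReal.ofReal_ne_top

/-- The value of the minmax problem is at most zero. -/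
lemma exists_forall_minmaxPayoff_le (q : WeightRule X d E) (hev : IsMeasurableEvents ev) (t : ℕ)
    (π : Transcript X d t) (x : X) {ε : ℝ} (hε : 0 < ε) :
    ∃ ψ : ProbabilityMeasure (Outcome d), ∀ y,
      minmaxPayoff ev q t π x (ψ : Measure (Outcome d)) y ≤ ε := by
  obtain ⟨s, a, ha, h⟩ := exists_mixed_prediction (d := d) (Z := E × Fin d × ℤˣ)
    (fun z p => q.weight t π z * (((z.2.2 : ℤ) : ℝ) * ev z.1 t π x p)) (fun z => z.2.1)
    (fun p => by
      rw [← q.sum_weight t π]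
      refine Finset.sum_le_sum fun z _ => ?_
      have h := hev.mem_Icc z.1 t π x p
      rw [abs_mul, abs_mul, abs_units_cast, one_mul, abs_of_nonneg h.1,
        abs_of_nonneg (q.weight_nonneg t π z)]
      exact mul_le_of_le_one_right (q.weight_nonneg t π z) h.2) hε
  refine ⟨⟨mixture s a, isProbabilityMeasure_mixture ha⟩, fun y => ?_⟩
  rw [minmaxPayoff_eq, ProbabilityMeasure.coe_mk, integral_mixture ha]
  refine le_trans (le_of_eq ?_) (h y)
  simp only [gain, mul_assoc]

/-- Near-minimizers of a worst-case bilinear payoff can be chosen measurably in the weights. -/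
lemma exists_measurable_near_minimizer {Z C : Type*} [Fintype Z]
    (g : C → Z → Outcome d → Outcome d → ℝ) (hg : ∀ c z p y, |g c z p y| ≤ 1)
    (hgm : ∀ c z y, Measurable fun p => g c z p y) {ε : ℝ} (hε : 0 < ε) :
    ∃ (n : (Z → ℝ) → ℕ) (Ψ : ℕ → C → ProbabilityMeasure (Outcome d)), Measurable n ∧
      ∀ (w : Z → ℝ) (c : C) (ψ : ProbabilityMeasure (Outcome d)),
        (⨆ y, ∫ p, ∑ z, w z * g c z p y ∂(Ψ (n w) c : Measure (Outcome d))) ≤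
          (⨆ y, ∫ p, ∑ z, w z * g c z p y ∂(ψ : Measure (Outcome d))) + ε := by
  classical
  let V (w : Z → ℝ) (c : C) (ψ : ProbabilityMeasure (Outcome d)) (y : Outcome d) : ℝ :=
    ∫ p, ∑ z, w z * g c z p y ∂(ψ : Measure (Outcome d))
  have hbound (w : Z → ℝ) (c p y) : |∑ z, w z * g c z p y| ≤ ∑ z, |w z| :=
    (Finset.abs_sum_le_sum_abs _ _).trans <| Finset.sum_le_sum fun z _ => by
      rw [abs_mul]; exact mul_le_of_le_one_right (abs_nonneg _) (hg c z p y)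
  have hmeas (w : Z → ℝ) (c y) : Measurable fun p => ∑ z, w z * g c z p y :=
    Finset.measurable_fun_sum _ fun z _ => (hgm c z y).const_mul _
  have hint (w : Z → ℝ) (c y) (ψ : ProbabilityMeasure (Outcome d)) :
      Integrable (fun p => ∑ z, w z * g c z p y) (ψ : Measure (Outcome d)) :=
    Integrable.of_bound (hmeas w c y).aestronglyMeasurable (∑ z, |w z|)
      (Filter.Eventually.of_forall fun p => hbound w c p y)
  have hV (w c ψ y) : |V w c ψ y| ≤ ∑ z, |w z| := by
    simpa using norm_integral_le_of_norm_le_const (μ := (ψ : Measure (Outcome d)))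
      (f := fun p => ∑ z, w z * g c z p y)
      (Filter.Eventually.of_forall fun p => hbound w c p y)
  have hbdd (w c ψ) : BddAbove (Set.range (V w c ψ)) :=
    ⟨∑ z, |w z|, by rintro _ ⟨y, rfl⟩; exact (abs_le.1 (hV w c ψ y)).2⟩
  have : Nonempty (Outcome d) := ⟨⟨0, le_rfl, zero_le_one⟩⟩
  -- The worst-case payoff is 1-Lipschitz in the weights for the `ℓ¹` norm, uniformly in `ψ`.
  have hlip (w w' c ψ) : (⨆ y, V w c ψ y) ≤ (⨆ y, V w' c ψ y) + ∑ z, |w z - w' z| := by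
    refine ciSup_le fun y => ?_
    have h1 : V w c ψ y = V w' c ψ y + V (fun z => w z - w' z) c ψ y := by
      simp only [V]
      rw [← integral_add (hint _ _ _ _) (hint _ _ _ _)]
      congr 1 with p
      rw [← Finset.sum_add_distrib]
      exact Finset.sum_congr rfl fun z _ => by ring
    rw [h1]
    exact add_le_add (le_ciSup (hbdd w' c ψ) y) (abs_le.1 (hV _ c ψ y)).2
  have hexists (w c) : ∃ ψ, ∀ ψ', (⨆ y, V w c ψ y) ≤ (⨆ y, V w c ψ' y) + ε / 3 := by
    have hne : Nonempty (ProbabilityMeasure (Outcome d)) :=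
      ⟨⟨Measure.dirac ⟨0, le_rfl, zero_le_one⟩, inferInstance⟩⟩
    have hb : BddBelow (Set.range fun ψ => ⨆ y, V w c ψ y) := by
      refine ⟨-∑ z, |w z|, ?_⟩
      rintro _ ⟨ψ, rfl⟩
      exact (abs_le.1 (hV w c ψ ⟨0, le_rfl, zero_le_one⟩)).1.trans (le_ciSup (hbdd w c ψ) _)
    obtain ⟨ψ, hψ⟩ := exists_lt_of_ciInf_lt
      (show (⨅ ψ, ⨆ y, V w c ψ y) < (⨅ ψ, ⨆ y, V w c ψ y) + ε / 3 by linarith)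
    exact ⟨ψ, fun ψ' => hψ.le.trans (add_le_add_left (ciInf_le hb ψ') _)⟩
  choose Φ hΦ using hexists
  -- Rounding `w` to the first close enough member of a dense sequence makes the selection countably
  -- valued and measurable.
  have hdense (w : Z → ℝ) : ∃ n, ∑ z, |w z - TopologicalSpace.denseSeq (Z → ℝ) n z| < ε / 3 := by
    have hopen : IsOpen {w' : Z → ℝ | ∑ z, |w z - w' z| < ε / 3} :=
      isOpen_lt (by fun_prop) continuous_const
    obtain ⟨_, h, n, rfl⟩ := (TopologicalSpace.denseRange_denseSeq (Z → ℝ)).inter_open_nonempty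
      _ hopen ⟨w, by simp [hε]⟩
    exact ⟨n, h⟩
  refine ⟨fun w => Nat.find (hdense w), fun n c => Φ (TopologicalSpace.denseSeq (Z → ℝ) n) c,
    measurable_find _ fun k => ?_, fun w c ψ => ?_⟩
  · exact measurableSet_lt (by fun_prop) measurable_const
  · have hn := Nat.find_spec (hdense w)
    set w' := TopologicalSpace.denseSeq (Z → ℝ) (Nat.find (hdense w))
    have h1 := hlip w w' c (Φ w' c)
    have h2 := hΦ w' c ψ
    have h3 := hlip w' w c ψ
    have h4 : ∑ z, |w' z - w z| = ∑ z, |w z - w' z| :=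
      Finset.sum_congr rfl fun z _ => abs_sub_comm _ _
    change (⨆ y, V w c (Φ w' c) y) ≤ (⨆ y, V w c ψ y) + ε
    -- One `ε / 3` for near-minimality at `w'`, and one for each passage between `w` and `w'`.
    linarith

/-- If the events depend on the past and the feature through countably many configurations only,
then approximate instantiations of unbiased prediction exist. -/
lemma exists_isUnbiasedPrediction {C : Type*} [Countable C] [MeasurableSpace C]
    [MeasurableSingletonClass C] (q : WeightRule X d E)
    (c : (t : ℕ) → Transcript X d t × X → C) (hc : ∀ t, Measurable (c t))
    (ev' : E → C → Outcome d → ℝ) (hev' : ∀ e c p, ev' e c p ∈ Set.Icc (0 : ℝ) 1)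
    (hev'm : ∀ e c, Measurable (ev' e c))
    (hfac : ∀ e t π x p, ev e t π x p = ev' e (c t (π, x)) p) (T : ℕ) {ε : ℝ} (hε : 0 < ε) :
    ∃ F : Forecaster X d, IsUnbiasedPrediction T ev q ε F := by
  obtain ⟨n, Ψ, hn, h⟩ := exists_measurable_near_minimizer (d := d) (Z := E × Fin d × ℤˣ)
    (fun (c : C) z p y => ((z.2.2 : ℤ) : ℝ) * ev' z.1 c p * (p.1 z.2.1 - y.1 z.2.1))
    (fun c z p y => by
      rw [abs_mul, abs_mul, abs_units_cast, one_mul, abs_of_nonneg (hev' _ _ _).1]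
      exact mul_le_one₀ (hev' _ _ _).2 (abs_nonneg _) (p.abs_sub_le_one y _))
    (fun c z y => ((hev'm z.1 c).const_mul _).mul ((measurable_coord z.2.1).sub_const _)) hε
  -- On a countable space with measurable singletons every function is measurable, so the arbitrary
  -- choices in `Ψ` still form a kernel.
  let κ : Kernel (ℕ × C) (Outcome d) :=
    Kernel.ofFunOfCountable fun a => (Ψ a.1 a.2 : Measure (Outcome d))
  have hκ : IsMarkovKernel κ := ⟨fun a => inferInstanceAs
    (IsProbabilityMeasure (Ψ a.1 a.2 : Measure (Outcome d)))⟩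
  have hidx (t : ℕ) : Measurable fun a : Transcript X d t × X => (n (q.weight t a.1), c t a) :=
    (hn.comp ((measurable_pi_lambda _ fun z => q.measurable_weight t z).comp
      measurable_fst)).prodMk (hc t)
  refine ⟨⟨fun t => κ.comap _ (hidx t), fun t => inferInstance⟩, fun t _ π x ψ => ?_⟩
  have := h (q.weight t π) (c t (π, x)) ψ
  simp only [minmaxPayoff_eq, gain, hfac]
  exact this

end Minmax

/-! ### The total wealth along a play -/

section Play

variable {X : Type*} [MeasurableSpace X] {d : ℕ} {E : Type*} [Fintype E] {ev : E → Event X d}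

/-- The law is compared with mixtures whose worst-case payoff is at most an arbitrary `ε' > 0`. -/
lemma IsUnbiasedPrediction.minmaxPayoff_le {T : ℕ} {q : WeightRule X d E} {ε : ℝ}
    {F : Forecaster X d} (hF : IsUnbiasedPrediction T ev q ε F) (hev : IsMeasurableEvents ev)
    {t : ℕ} (ht : t < T) (π : Transcript X d t) (x : X) (y : Outcome d) :
    minmaxPayoff ev q t π x (F.law t (π, x)) y ≤ ε := by
  have := F.isMarkovKernel_law t
  have : Nonempty (Outcome d) := ⟨y⟩
  refine le_of_forall_pos_le_add fun ε' hε' => ?_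
  obtain ⟨ψ, hψ⟩ := exists_forall_minmaxPayoff_le q hev t π x hε'
  calc _ ≤ _ := le_ciSup (bddAbove_minmaxPayoff q hev t π x (F.law t (π, x))) y
    _ ≤ _ := hF t ht π x ψ
    _ ≤ ε + ε' := by linarith [ciSup_le hψ]

variable {Ω : Type*} [MeasurableSpace Ω] {P : Measure Ω} {F : Forecaster X d} {T : ℕ}
  {x : ℕ → Ω → X} {p y : ℕ → Ω → Outcome d}

lemma IsPlay.measurable_transcript (h : IsPlay F T P x p y) {t : ℕ} (ht : t ≤ T) :
    Measurable fun ω => transcript (fun s => x s ω) (fun s => p s ω) (fun s => y s ω) t :=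
  measurable_pi_lambda _ fun s =>
    have hs : (s : ℕ) < T := s.2.trans_le ht
    (h.measurable_feature s hs).prodMk ((h.measurable_prediction s hs).prodMk
      (h.measurable_outcome s hs))

lemma IsPlay.integrable_totalWealth [IsProbabilityMeasure P] (h : IsPlay F T P x p y)
    (hev : IsMeasurableEvents ev) (n : ℕ) {t : ℕ} (ht : t ≤ T) :
    Integrable (fun ω => totalWealth ev n t
      (transcript (fun s => x s ω) (fun s => p s ω) (fun s => y s ω) t)) P :=
  Integrable.of_bound
    ((hev.measurable_totalWealth n t).comp (h.measurable_transcript ht)).aestronglyMeasurable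
    (Fintype.card (E × Fin d × ℤˣ) * (n * 2 ^ t))
    (Filter.Eventually.of_forall fun ω => by
      rw [Real.norm_of_nonneg (hev.totalWealth_nonneg ..)]
      exact hev.totalWealth_le ..)

variable [Nonempty (E × Fin d × ℤˣ)]

lemma IsMeasurableEvents.abs_sum_stake_mul_gain_le (hev : IsMeasurableEvents ev) {n : ℕ}
    (hn : 0 < n) (t : ℕ) (π : Transcript X d t) (x : X) (p y : Outcome d) :
    |∑ z, stake ev n t π z * gain ev t π x p y z| ≤
      Fintype.card (E × Fin d × ℤˣ) * (n * 2 ^ t) := by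
  have h0 : 0 ≤ ∑ z, stake ev n t π z := Finset.sum_nonneg fun z _ => hev.stake_nonneg n t π z
  rw [hev.sum_stake_mul_gain hn, abs_mul, abs_of_nonneg h0]
  exact (mul_le_of_le_one_right h0 ((stakeWeights hev hn).abs_sum_weight_mul_gain_le hev ..)).trans
    ((hev.sum_stake_le n t π).trans (hev.totalWealth_le n t π))

/-- Given past, feature and outcome, the expected increment is the total stake times the minmax
payoff at that outcome, hence at most `ε` times the current wealth. -/
lemma IsPlay.integral_totalWealth_succ_le [IsProbabilityMeasure P] (h : IsPlay F T P x p y)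
    (hev : IsMeasurableEvents ev) {n : ℕ} (hn : 0 < n) {ε : ℝ} (hε : 0 ≤ ε)
    (hF : IsUnbiasedPrediction T ev (stakeWeights hev hn) ε F) {t : ℕ} (ht : t < T) :
    ∫ ω, totalWealth ev n (t + 1)
        (transcript (fun s => x s ω) (fun s => p s ω) (fun s => y s ω) (t + 1)) ∂P ≤
      (1 + ε) * ∫ ω, totalWealth ev n t
        (transcript (fun s => x s ω) (fun s => p s ω) (fun s => y s ω) t) ∂P := by
  have := F.isMarkovKernel_law t
  let Y (ω : Ω) := ((transcript (fun s => x s ω) (fun s => p s ω) (fun s => y s ω) t, x t ω), y t ω)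
  let D (a : ((Transcript X d t × X) × Outcome d) × Outcome d) : ℝ :=
    ∑ z, stake ev n t a.1.1.1 z * gain ev t a.1.1.1 a.1.1.2 a.2 a.1.2 z
  let B : ℝ := Fintype.card (E × Fin d × ℤˣ) * (n * 2 ^ t)
  have hY : Measurable Y := ((h.measurable_transcript ht.le).prodMk
    (h.measurable_feature t ht)).prodMk (h.measurable_outcome t ht)
  have hp := h.measurable_prediction t ht
  have hD : Measurable D := Finset.measurable_fun_sum _ fun z _ =>
    ((hev.measurable_stake n t z).comp measurable_fst.fst.fst).mul (hev.measurable_gain t z)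
  have hDB (a) : ‖D a‖ ≤ B := hev.abs_sum_stake_mul_gain_le hn ..
  have hlaw := h.hasCondDistrib t ht
  have := Measure.isProbabilityMeasure_map (μ := P) hY.aemeasurable
  have hΦ := h.integrable_totalWealth hev n ht.le
  have hDY : Integrable (fun ω => D (Y ω, p t ω)) P :=
    Integrable.of_bound (hD.comp (hY.prodMk hp)).aestronglyMeasurable B
      (Filter.Eventually.of_forall fun ω => hDB _)
  have hDint : ∫ ω, D (Y ω, p t ω) ∂P ≤ ε * ∫ ω, totalWealth ev n t
      (transcript (fun s => x s ω) (fun s => p s ω) (fun s => y s ω) t) ∂P := by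
    -- The conditional law of the prediction ignores the outcome component of `Y`; this is where the
    -- independence of prediction and outcome enters.
    have h1 : ∫ ω, D (Y ω, p t ω) ∂P =
        ∫ a, D a ∂((P.map Y) ⊗ₘ Kernel.prodMkRight (Outcome d) (F.law t)) := by
      rw [← hlaw.map_eq, integral_map (hY.prodMk hp).aemeasurable hD.aestronglyMeasurable]
    have hDκ : Integrable D ((P.map Y) ⊗ₘ Kernel.prodMkRight (Outcome d) (F.law t)) :=
      Integrable.of_bound hD.aestronglyMeasurable B (Filter.Eventually.of_forall hDB)
    have hm := hev.measurable_totalWealth n t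
    have hΦm : Measurable fun a : (Transcript X d t × X) × Outcome d =>
        ε * totalWealth ev n t a.1.1 := (hm.comp measurable_fst.fst).const_mul _
    rw [h1, Measure.integral_compProd hDκ, ← integral_const_mul]
    -- The integrability lemma is stated for kernels, so `P.map Y` is read as a constant kernel on
    -- `Unit`.
    refine le_trans (integral_mono (Integrable.integral_compProd (κ := Kernel.const Unit (P.map Y))
      (η := Kernel.prodMkLeft Unit (Kernel.prodMkRight (Outcome d) (F.law t))) (a := ()) hDκ) (g := fun a => ε * totalWealth ev n t a.1.1)
      ?_ fun a => ?_) (le_of_eq ?_)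
    · refine Integrable.of_bound hΦm.aestronglyMeasurable (ε * B)
        (Filter.Eventually.of_forall fun a => ?_)
      rw [Real.norm_of_nonneg (mul_nonneg hε (hev.totalWealth_nonneg ..))]
      exact mul_le_mul_of_nonneg_left (hev.totalWealth_le ..) hε
    · have h2 := hF.minmaxPayoff_le hev ht a.1.1 a.1.2 a.2
      simp only [D, Kernel.prodMkRight_apply]
      simp_rw [hev.sum_stake_mul_gain hn]
      rw [integral_const_mul, ← minmaxPayoff_eq, mul_comm]
      have h0 : 0 ≤ ∑ z, stake ev n t a.1.1 z :=
        Finset.sum_nonneg fun z _ => hev.stake_nonneg n t _ z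
      exact (mul_le_mul_of_nonneg_right h2 h0).trans
        (mul_le_mul_of_nonneg_left (hev.sum_stake_le n t _) hε)
    · rw [integral_map hY.aemeasurable hΦm.aestronglyMeasurable]
  calc _ = ∫ ω, (totalWealth ev n t (transcript (fun s => x s ω) (fun s => p s ω)
        (fun s => y s ω) t) + D (Y ω, p t ω)) ∂P := by
        congr 1 with ω
        -- `Fin.init` of the longer transcript is the shorter one by definition.
        exact totalWealth_succ n t _
    _ ≤ _ := by rw [integral_add hΦ hDY]; linarith

lemma IsPlay.integral_totalWealth_le [IsProbabilityMeasure P] (h : IsPlay F T P x p y)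
    (hev : IsMeasurableEvents ev) {n : ℕ} (hn : 0 < n) {ε : ℝ} (hε : 0 ≤ ε)
    (hF : IsUnbiasedPrediction T ev (stakeWeights hev hn) ε F) {t : ℕ} (ht : t ≤ T) :
    ∫ ω, totalWealth ev n t
        (transcript (fun s => x s ω) (fun s => p s ω) (fun s => y s ω) t) ∂P ≤
      (1 + ε) ^ t * (Fintype.card (E × Fin d × ℤˣ) * n) := by
  induction t with
  | zero => simp [totalWealth_zero]
  | succ t ih =>
    refine (h.integral_totalWealth_succ_le hev hn hε hF ht).trans ?_
    rw [pow_succ', mul_assoc]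
    exact mul_le_mul_of_nonneg_left (ih (Nat.le_of_succ_le ht)) (by linarith)

/-- With high probability the total wealth never exceeds its initial value by much. -/
lemma IsPlay.exists_totalWealth_le [IsProbabilityMeasure P] (h : IsPlay F T P x p y)
    (hev : IsMeasurableEvents ev) (hT : 0 < T)
    (hF : IsUnbiasedPrediction T ev (stakeWeights hev hT) (1 / T) F) {δ : ℝ} (hδ : 0 < δ) :
    ∃ G : Set Ω, MeasurableSet G ∧ ENNReal.ofReal (1 - δ) ≤ P G ∧ ∀ ω ∈ G,
      totalWealth ev T T (transcript (fun s => x s ω) (fun s => p s ω) (fun s => y s ω) T) ≤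
        Real.exp 1 * (Fintype.card (E × Fin d × ℤˣ) * T) / δ := by
  set f : Ω → ℝ := fun ω => totalWealth ev T T
    (transcript (fun s => x s ω) (fun s => p s ω) (fun s => y s ω) T) with hf
  set N : ℝ := Fintype.card (E × Fin d × ℤˣ) * T with hN
  have hNpos : 0 < N := by have := Fintype.card_pos (α := E × Fin d × ℤˣ); positivity
  have hfm : Measurable f := (hev.measurable_totalWealth T T).comp (h.measurable_transcript le_rfl)
  set c := Real.exp 1 * N / δ with hc
  have hcpos : 0 < c := by positivity
  have hS : MeasurableSet {ω | c ≤ f ω} := measurableSet_le measurable_const hfm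
  have hint : ∫ ω, f ω ∂P ≤ Real.exp 1 * N := by
    refine (h.integral_totalWealth_le hev hT (by positivity) hF le_rfl).trans
      (mul_le_mul_of_nonneg_right ?_ hNpos.le)
    -- The accuracy `1/T` costs only `(1 + 1/T)^T ≤ e`.
    have h1 : (1 + 1 / (T : ℝ)) ^ T ≤ Real.exp (1 / T) ^ T :=
      pow_le_pow_left₀ (by positivity) (by linarith [Real.add_one_le_exp (1 / (T : ℝ))]) T
    rwa [← Real.exp_nat_mul, mul_one_div_cancel (by positivity)] at h1
  have hmarkov := (mul_meas_ge_le_integral_of_nonneg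
    (Filter.Eventually.of_forall fun ω => hev.totalWealth_nonneg T T _ : 0 ≤ᵐ[P] f)
    (h.integrable_totalWealth hev T le_rfl) c).trans hint
  have hprob : P.real {ω | c ≤ f ω} ≤ δ := by
    rw [hc, div_mul_eq_mul_div, div_le_iff₀ hδ] at hmarkov
    exact le_of_mul_le_mul_left hmarkov (by positivity)
  refine ⟨{ω | c ≤ f ω}ᶜ, hS.compl, ?_, fun ω hω => (not_le.1 (show ¬c ≤ f ω from hω)).le⟩
  rw [← ENNReal.ofReal_toReal (measure_ne_top P _)]
  refine ENNReal.ofReal_le_ofReal ?_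
  change 1 - δ ≤ P.real {ω | c ≤ f ω}ᶜ
  rw [probReal_compl_eq_one_sub hS]
  linarith

end Play

/-! ### From wealth to bias -/

section Bias

/-- First-order Taylor bound for `log (1 + u)`: the remainder is at most `u² / (1 - |u|)`, hence at
most `2u²`. -/
lemma exp_sub_two_mul_sq_le {u : ℝ} (hu : |u| ≤ 1 / 2) : Real.exp (u - 2 * u ^ 2) ≤ 1 + u := by
  have h1 : 0 < 1 + u := by linarith [(abs_le.1 hu).1]
  rw [← Real.le_log_iff_exp_le h1]
  have h := Real.abs_log_sub_add_sum_range_le (x := -u) (by rw [abs_neg]; linarith) 1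
  simp only [Finset.range_one, Finset.sum_singleton, abs_neg] at h
  have h2 : |u| ^ (1 + 1) / (1 - |u|) ≤ 2 * u ^ 2 := by
    rw [div_le_iff₀ (by linarith), show |u| ^ (1 + 1) = u ^ 2 from sq_abs u]
    nlinarith [sq_nonneg u]
  have h3 := (abs_le.1 (h.trans h2)).1
  norm_num at h3
  linarith

/-- Since events lie in `[0, 1]`, a squared gain is at most the event, so the second-order terms add
up to the event count rather than to the number of rounds. -/
lemma exp_le_wealth {X : Type*} [MeasurableSpace X] {d : ℕ} {E : Type*} {ev : E → Event X d}
    (hev : IsMeasurableEvents ev) {η : ℝ} (h0 : 0 ≤ η) (h1 : η ≤ 1 / 2) (z : E × Fin d × ℤˣ)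
    (x : ℕ → X) (p y : ℕ → Outcome d) (t : ℕ) :
    Real.exp (η * ∑ s ∈ Finset.range t, gain ev s (transcript x p y s) (x s) (p s) (y s) z -
        2 * η ^ 2 * ∑ s ∈ Finset.range t, ev z.1 s (transcript x p y s) (x s) (p s)) ≤
      wealth ev η z t (transcript x p y t) := by
  induction t with
  | zero => simp [wealth]
  | succ t ih =>
    have hw : wealth ev η z (t + 1) (transcript x p y (t + 1)) =
        wealth ev η z t (transcript x p y t) *
          (1 + η * gain ev t (transcript x p y t) (x t) (p t) (y t) z) := rfl
    set g := gain ev t (transcript x p y t) (x t) (p t) (y t) z with hg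
    set e := ev z.1 t (transcript x p y t) (x t) (p t) with he
    have hE : e ∈ Set.Icc (0 : ℝ) 1 := hev.mem_Icc _ _ _ _ _
    have hge : |g| ≤ e := abs_gain_le_event hE.1
    have hg2 : g ^ 2 ≤ e := by
      rw [← sq_abs]
      nlinarith [abs_nonneg g, hE.2]
    have hη : |η * g| ≤ 1 / 2 := by
      rw [abs_mul, abs_of_nonneg h0]
      nlinarith [abs_nonneg g, hE.2]
    rw [hw, Finset.sum_range_succ, Finset.sum_range_succ, ← hg, ← he]
    calc _ ≤ Real.exp (η * ∑ s ∈ Finset.range t,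
            gain ev s (transcript x p y s) (x s) (p s) (y s) z -
          2 * η ^ 2 * ∑ s ∈ Finset.range t, ev z.1 s (transcript x p y s) (x s) (p s)) *
          Real.exp (η * g - 2 * (η * g) ^ 2) := by
          rw [← Real.exp_add]
          refine Real.exp_le_exp.2 ?_
          nlinarith [mul_le_mul_of_nonneg_left hg2 (sq_nonneg η)]
      _ ≤ _ := mul_le_mul ih (exp_sub_two_mul_sq_le hη) (Real.exp_pos _).le
          (hev.wealth_pos h0 h1 z t _).le

/-- Optimizing the learning rate over `1/2, 1/3, …, 1/(T+1)`. -/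
lemma le_of_forall_rate {T n : ℕ} (hT : 0 < T) (hn : n ≤ T) {g Λ : ℝ} (hΛ : 1 < Λ)
    (h : ∀ j < T, rate j * g - 2 * rate j ^ 2 * n ≤ Λ) : g ≤ 3 * √(n * Λ) + 2 * Λ := by
  have hΛ0 : 0 < Λ := by linarith
  have hr0 : 0 ≤ (n : ℝ) / Λ := by positivity
  -- The optimal rate has order `1/r`. The index `⌊r⌋` gives the rate `1/m` with `r ≤ m ≤ r + 2`; it
  -- is admissible because `Λ > 1` and `n ≤ T` force `r < T`.
  set r := √((n : ℝ) / Λ) with hr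
  have hrT : r < T := by
    rw [hr, Real.sqrt_lt' (by positivity), div_lt_iff₀ hΛ0]
    have h1 : (n : ℝ) ≤ T := by exact_mod_cast hn
    have h2 : (1 : ℝ) ≤ T := by exact_mod_cast hT
    have h3 : (T : ℝ) ≤ T ^ 2 := by nlinarith
    have h4 : (T : ℝ) ^ 2 < T ^ 2 * Λ := lt_mul_of_one_lt_right (by positivity) hΛ
    linarith
  have hj := h ⌊r⌋₊ ((Nat.floor_lt (Real.sqrt_nonneg _)).2 hrT)
  set m : ℝ := (⌊r⌋₊ : ℝ) + 2 with hm
  have hmr : m ≤ r + 2 := by linarith [Nat.floor_le (Real.sqrt_nonneg ((n : ℝ) / Λ))]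
  have hrm : r ≤ m := by linarith [(Nat.lt_floor_add_one r).le]
  have hmpos : 0 < m := by positivity
  have hrate : rate ⌊r⌋₊ = 1 / m := rfl
  rw [hrate] at hj
  have hg : g ≤ 2 * (n / m) + Λ * m := by
    have := mul_le_mul_of_nonneg_right hj hmpos.le
    have e : (1 / m * g - 2 * (1 / m) ^ 2 * n) * m = g - 2 * (n / m) := by field_simp
    linarith
  have hrΛ : r * Λ = √(n * Λ) := by
    rw [show (n : ℝ) * Λ = n / Λ * (Λ ^ 2) by field_simp, Real.sqrt_mul hr0,
      Real.sqrt_sq hΛ0.le]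
  have hnr : (n : ℝ) = r * (r * Λ) := by
    rw [← mul_assoc, Real.mul_self_sqrt hr0]; field_simp
  have hnm : (n : ℝ) / m ≤ √(n * Λ) := by
    rw [div_le_iff₀ hmpos, ← hrΛ]
    nlinarith [Real.sqrt_nonneg ((n : ℝ) / Λ), mul_nonneg (Real.sqrt_nonneg ((n : ℝ) / Λ)) hΛ0.le]
  nlinarith

/-- The numerical form of the bias bound: `n` rounds played out of `r`. -/
lemma bias_bound {M T δ g : ℝ} {n r : ℕ} (hM : 1 ≤ M) (hMT : 2 ≤ M * T) (hδ : 0 < δ) (hδ1 : δ < 1)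
    (hnr : n ≤ r) (hgn : g ≤ n)
    (h : g ≤ 3 * √(n * (1 + Real.log 2 + Real.log (M * T) + Real.log (1 / δ))) +
      2 * (1 + Real.log 2 + Real.log (M * T) + Real.log (1 / δ))) :
    g ≤ 8 * (Real.log (M * T) + √(Real.log (M * T) * n) + √(Real.log (M / δ) * r)) := by
  set l := Real.log (M * T) with hl
  set D := Real.log (1 / δ) with hD
  have hl2 : Real.log 2 ≤ l := Real.log_le_log (by norm_num) hMT
  have hlog2 := Real.log_two_gt_d9
  have hl0 : 0 ≤ l := by linarith
  have hD0 : 0 ≤ D := Real.log_nonneg (by rw [le_div_iff₀ hδ]; linarith)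
  have hDM : D ≤ Real.log (M / δ) := Real.log_le_log (by positivity)
    (div_le_div_of_nonneg_right hM hδ.le)
  have hr0 : (0 : ℝ) ≤ r := Nat.cast_nonneg r
  have hn0 : (0 : ℝ) ≤ n := Nat.cast_nonneg n
  have hnr' : (n : ℝ) ≤ r := by exact_mod_cast hnr
  have hs1 : √(D * r) ≤ √(Real.log (M / δ) * r) :=
    Real.sqrt_le_sqrt (mul_le_mul_of_nonneg_right hDM hr0)
  have hs2 := Real.sqrt_nonneg (l * n)
  have hs3 := Real.sqrt_nonneg (D * r)
  -- No additive `log (1/δ)` survives: either `D ≤ r`, so `D ≤ √(D r)`, or the trivial bound `g ≤ n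
  -- ≤ r ≤ √(D r)` suffices. In the first case `1 + log 2 + l ≤ 4l` and the final factor 2 produce
  -- the constant 8.
  rcases le_total D r with hDr | hDr
  · have hD' : D ≤ √(D * r) := Real.le_sqrt_of_sq_le (by nlinarith)
    have hsplit : √(n * (1 + Real.log 2 + l + D)) ≤ 2 * √(l * n) + √(D * r) := by
      rw [Real.sqrt_le_left (by positivity)]
      nlinarith [Real.sq_sqrt (mul_nonneg hl0 hn0), Real.sq_sqrt (mul_nonneg hD0 hr0),
        mul_nonneg hs2 hs3, mul_nonneg hn0 hD0, mul_le_mul_of_nonneg_left hnr' hD0,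
        mul_le_mul_of_nonneg_left (show 1 + Real.log 2 + l ≤ 4 * l by linarith) hn0]
    linarith
  · have : (r : ℝ) ≤ √(D * r) := Real.le_sqrt_of_sq_le (by nlinarith)
    linarith

end Bias

/-! ### The decision events -/

section DecisionEvents

variable {X A κ ι : Type*} [MeasurableSpace X] [Fintype A] [Fintype κ] {d J : ℕ}

lemma measurableSet_finset_eq {Ω : Type*} [MeasurableSpace Ω] {f : Ω → Finset A}
    (hf : ∀ a, MeasurableSet {ω | a ∈ f ω}) (s : Finset A) : MeasurableSet {ω | f ω = s} := by
  have : {ω | f ω = s} = ⋂ a, {ω | a ∈ f ω ↔ a ∈ s} := by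
    ext ω
    simp [Finset.ext_iff]
  rw [this]
  refine MeasurableSet.iInter fun a => ?_
  exact (hf a).iff (MeasurableSet.const _)

namespace Agent

omit [MeasurableSpace X] [Fintype κ] in
lemma mem_candidates_succ (ag : Agent A d J) (h : κ → ℕ → X → Bool) (S : κ) (t : ℕ)
    (π : Transcript X d (t + 1)) (a : A) :
    a ∈ ag.candidates h S (t + 1) π ↔ a ∈ ag.candidates h S t (Fin.init π) ∧
      (h S t (π (Fin.last t)).1 = true →
        ∀ j, ag.constraint j a (π (Fin.last t)).2.2 ≤ 0) := by
  rw [candidates]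
  split_ifs with hS
  · simp only [Finset.mem_sdiff, Finset.mem_filter, hS, forall_const]
    constructor
    · rintro ⟨h1, h2⟩
      exact ⟨h1, fun j => not_lt.1 fun hj => h2 ⟨h1, j, hj⟩⟩
    · rintro ⟨h1, h2⟩
      exact ⟨h1, fun ⟨_, j, hj⟩ => (h2 j).not_gt hj⟩
  · simp [hS]

omit [Fintype κ] in
lemma measurableSet_mem_candidates (ag : Agent A d J) {h : κ → ℕ → X → Bool}
    (hh : ∀ S t, Measurable (h S t)) (S : κ) (t : ℕ) (a : A) :
    MeasurableSet {π : Transcript X d t | a ∈ ag.candidates h S t π} := by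
  induction t with
  | zero => simp [candidates]
  | succ t ih =>
    have hl : Measurable fun π : Transcript X d (t + 1) => π (Fin.last t) := measurable_pi_apply _
    have h1 : MeasurableSet {π : Transcript X d (t + 1) | h S t (π (Fin.last t)).1 = true} :=
      ((hh S t).comp hl.fst) (measurableSet_singleton true)
    have h2 : MeasurableSet {π : Transcript X d (t + 1) |
        ∀ j, ag.constraint j a (π (Fin.last t)).2.2 ≤ 0} := by
      rw [Set.ofPred_forall]
      exact MeasurableSet.iInter fun j =>
        measurableSet_le ((ag.measurable_constraint j a).comp hl.snd.snd) measurable_const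
    simp only [mem_candidates_succ]
    exact (measurable_transcript_init t ih).inter (h1.imp h2)

lemma measurableSet_mem_unionSet (ag : Agent A d J) {h : κ → ℕ → X → Bool}
    (hh : ∀ S t, Measurable (h S t)) (t : ℕ) (a : A) :
    MeasurableSet {b : Transcript X d t × X | a ∈ ag.unionSet h t b.1 b.2} := by
  have : {b : Transcript X d t × X | a ∈ ag.unionSet h t b.1 b.2} =
      ⋃ S, {b | h S t b.2 = true} ∩ {b | a ∈ ag.candidates h S t b.1} := by
    ext b
    simp [unionSet]
  rw [this]
  exact MeasurableSet.iUnion fun S =>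
    (((hh S t).comp measurable_snd) (measurableSet_singleton true)).inter
      (measurable_fst (ag.measurableSet_mem_candidates hh S t a))

/-- The response depends on `p` only through the set of maximizers, so an arbitrary tie-breaking
rule causes no measurability problem. -/
lemma measurableSet_cbr_eq (ag : Agent A d J) (U : Finset A) (a : A) :
    MeasurableSet {p | ag.cbr U p = a} := by
  classical
  let f (p : Outcome d) : Finset A := U.filter fun a => ∀ b ∈ U, ag.utility b p ≤ ag.utility a p
  have hf (c : A) : MeasurableSet {p | c ∈ f p} := by
    simp only [f, Finset.mem_filter, Set.ofPred_and, Set.ofPred_forall]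
    exact (MeasurableSet.const _).inter (MeasurableSet.iInter fun b => MeasurableSet.iInter fun _ =>
      measurableSet_le (ag.measurable_utility b) (ag.measurable_utility c))
  have : {p | ag.cbr U p = a} = ⋃ s : {s : Finset A // ag.tie s = a}, {p | f p = s} := by
    ext p
    simp only [cbr, f, Set.mem_ofPred_eq, Set.mem_iUnion, Subtype.exists, exists_prop,
      exists_eq_right']
    constructor <;> intro h <;> convert h
  rw [this]
  exact MeasurableSet.iUnion fun s => measurableSet_finset_eq hf s

lemma utility_le_utility_cbr (ag : Agent A d J) {U : Finset A} {b : A} (hb : b ∈ U)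
    (p : Outcome d) : ag.utility b p ≤ ag.utility (ag.cbr U p) p := by
  classical
  obtain ⟨a, ha, hmax⟩ := U.exists_max_image (fun a => ag.utility a p) ⟨b, hb⟩
  have h := ag.tie_mem _ (⟨a, Finset.mem_filter.2 ⟨ha, hmax⟩⟩ : (U.filter fun a =>
    ∀ b ∈ U, ag.utility b p ≤ ag.utility a p).Nonempty)
  have h' := (Finset.mem_filter.1 h).2 b hb
  unfold cbr
  convert h'

omit [MeasurableSpace X] [Fintype κ] in
/-- The elimination never removes an action of the benchmark class. -/
lemma mem_candidates_of_mem_benchmark (ag : Agent A d J) (h : κ → ℕ → X → Bool) (S : κ) {T : ℕ}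
    (x : ℕ → X) (p y : ℕ → Outcome d) {a : A} (ha : a ∈ ag.benchmark (rounds h T S x) y) {t : ℕ}
    (ht : t ≤ T) : a ∈ ag.candidates h S t (transcript x p y t) := by
  induction t with
  | zero => simp [candidates]
  | succ t ih =>
    rw [mem_candidates_succ]
    refine ⟨ih (Nat.le_of_succ_le ht), fun hS => ha t ?_⟩
    exact Finset.mem_filter.2 ⟨Finset.mem_range.2 ht, hS⟩

omit [MeasurableSpace X] in
lemma utility_le_utility_played (ag : Agent A d J) (h : κ → ℕ → X → Bool) (S : κ) {T : ℕ}
    (x : ℕ → X) (p y : ℕ → Outcome d) {b : A} (hb : b ∈ ag.benchmark (rounds h T S x) y) {t : ℕ}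
    (ht : t ∈ rounds h T S x) :
    ag.utility b (p t) ≤ ag.utility (ag.played h x p y t) (p t) := by
  classical
  obtain ⟨ht1, ht2⟩ := Finset.mem_filter.1 ht
  refine ag.utility_le_utility_cbr ?_ _
  simp only [unionSet, Finset.mem_biUnion, Finset.mem_filter, Finset.mem_univ, true_and]
  exact ⟨S, ht2, ag.mem_candidates_of_mem_benchmark h S x p y hb (Finset.mem_range.1 ht1).le⟩

end Agent

/-- The active subsequences and the sets `U_t` of all agents, which determine the decision
events. -/
noncomputable def configuration (agent : ι → Agent A d J) (h : κ → ℕ → X → Bool) (t : ℕ)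
    (b : Transcript X d t × X) : (κ → Bool) × (ι → Finset A) :=
  (fun S => h S t b.2, fun i => (agent i).unionSet h t b.1 b.2)

open Classical in
/-- The decision event as a function of the configuration. -/
noncomputable def configurationEvent (agent : ι → Agent A d J) (e : κ × ι × A)
    (c : (κ → Bool) × (ι → Finset A)) (p : Outcome d) : ℝ :=
  if c.1 e.1 = true ∧ (agent e.2.1).cbr (c.2 e.2.1) p = e.2.2 then 1 else 0

omit [MeasurableSpace X] in
lemma decisionEvent_eq_configurationEvent (agent : ι → Agent A d J) (h : κ → ℕ → X → Bool)
    (e : κ × ι × A) (t : ℕ) (π : Transcript X d t) (x : X) (p : Outcome d) :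
    decisionEvent agent h e t π x p =
      configurationEvent agent e (configuration agent h t (π, x)) p := rfl

omit [Fintype A] [Fintype κ] in
lemma configurationEvent_mem_Icc (agent : ι → Agent A d J) (e : κ × ι × A)
    (c : (κ → Bool) × (ι → Finset A)) (p : Outcome d) :
    configurationEvent agent e c p ∈ Set.Icc (0 : ℝ) 1 := by
  unfold configurationEvent
  split_ifs <;> simp

omit [Fintype κ] in
lemma measurable_configurationEvent (agent : ι → Agent A d J) (e : κ × ι × A)
    (c : (κ → Bool) × (ι → Finset A)) : Measurable (configurationEvent agent e c) :=
  Measurable.ite ((MeasurableSet.const _).inter ((agent e.2.1).measurableSet_cbr_eq _ _))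
    measurable_const measurable_const

variable [Fintype ι]

lemma measurableSet_configuration_eq (agent : ι → Agent A d J) {h : κ → ℕ → X → Bool}
    (hh : ∀ S t, Measurable (h S t)) (t : ℕ) (c : (κ → Bool) × (ι → Finset A)) :
    MeasurableSet (configuration agent h t ⁻¹' {c}) := by
  have : configuration agent h t ⁻¹' {c} = (⋂ S, {b | h S t b.2 = c.1 S}) ∩
      ⋂ i, {b | (agent i).unionSet h t b.1 b.2 = c.2 i} := by
    ext b
    simp [configuration, Prod.ext_iff, funext_iff]
  rw [this]
  exact (MeasurableSet.iInter fun S =>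
    ((hh S t).comp measurable_snd) (measurableSet_singleton (c.1 S))).inter
    (MeasurableSet.iInter fun i =>
      measurableSet_finset_eq ((agent i).measurableSet_mem_unionSet hh t) _)

/-- The past and the feature enter only through a configuration from a finite type, where the
discrete σ-algebra reduces joint measurability to measurability in `p`. -/
lemma isMeasurableEvents_decisionEvent (agent : ι → Agent A d J) {h : κ → ℕ → X → Bool}
    (hh : ∀ S t, Measurable (h S t)) : IsMeasurableEvents (decisionEvent agent h) where
  mem_Icc e t π x p := configurationEvent_mem_Icc agent e (configuration agent h t (π, x)) p
  measurable e t := by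
    let : MeasurableSpace ((κ → Bool) × (ι → Finset A)) := ⊤
    have hc : Measurable (configuration agent h t) :=
      measurable_to_countable' (measurableSet_configuration_eq agent hh t)
    have he : Measurable fun b : ((κ → Bool) × (ι → Finset A)) × Outcome d =>
        configurationEvent agent e b.1 b.2 :=
      measurable_from_prod_countable_right (measurable_configurationEvent agent e)
    exact he.comp ((hc.comp measurable_fst).prodMk measurable_snd)

lemma exists_isUnbiasedPrediction_decisionEvent (agent : ι → Agent A d J)
    {h : κ → ℕ → X → Bool} (hh : ∀ S t, Measurable (h S t)) (q : WeightRule X d (κ × ι × A))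
    (T : ℕ) {ε : ℝ} (hε : 0 < ε) :
    ∃ F : Forecaster X d, IsUnbiasedPrediction T (decisionEvent agent h) q ε F := by
  let : MeasurableSpace ((κ → Bool) × (ι → Finset A)) := ⊤
  exact exists_isUnbiasedPrediction q (configuration agent h)
    (fun t => measurable_to_countable' (measurableSet_configuration_eq agent hh t))
    (configurationEvent agent) (configurationEvent_mem_Icc agent)
    (measurable_configurationEvent agent)
    (decisionEvent_eq_configurationEvent agent h) T hε

section Sums

omit [MeasurableSpace X] [Fintype ι]

lemma sum_decisionEvent_smul (agent : ι → Agent A d J) (h : κ → ℕ → X → Bool) (i : ι) (S : κ)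
    (a : A) (T : ℕ) (x : ℕ → X) (p y : ℕ → Outcome d) (f : ℕ → ℝ) :
    ∑ t ∈ Finset.range T, decisionEvent agent h (S, i, a) t (transcript x p y t) (x t) (p t) * f t =
      ∑ t ∈ roundsPlaying (rounds h T S x) ((agent i).played h x p y) a, f t := by
  classical
  rw [roundsPlaying, rounds, Finset.filter_filter, Finset.sum_filter]
  refine Finset.sum_congr rfl fun t _ => ?_
  simp only [decisionEvent, Agent.played, ite_mul, one_mul, zero_mul]
  congr

lemma sum_decisionEvent (agent : ι → Agent A d J) (h : κ → ℕ → X → Bool) (i : ι) (S : κ)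
    (a : A) (T : ℕ) (x : ℕ → X) (p y : ℕ → Outcome d) :
    ∑ t ∈ Finset.range T, decisionEvent agent h (S, i, a) t (transcript x p y t) (x t) (p t) =
      (roundsPlaying (rounds h T S x) ((agent i).played h x p y) a).card := by
  simpa using sum_decisionEvent_smul agent h i S a T x p y 1

lemma sum_gain_decisionEvent (agent : ι → Agent A d J) (h : κ → ℕ → X → Bool) (i : ι) (S : κ)
    (a : A) (k : Fin d) (σ : ℤˣ) (T : ℕ) (x : ℕ → X) (p y : ℕ → Outcome d) :
    ∑ t ∈ Finset.range T, gain (decisionEvent agent h) t (transcript x p y t) (x t) (p t) (y t)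
        ((S, i, a), k, σ) =
      ((σ : ℤ) : ℝ) * (∑ t ∈ roundsPlaying (rounds h T S x) ((agent i).played h x p y) a,
        ((p t : Fin d → ℝ) - (y t : Fin d → ℝ))) k := by
  rw [Finset.sum_apply, Finset.mul_sum, ← sum_decisionEvent_smul]
  refine Finset.sum_congr rfl fun t _ => ?_
  simp only [gain, Pi.sub_apply]
  ring

end Sums

end DecisionEvents

/-! ### From bias to regret -/

namespace Agent

variable {A : Type*} {d J : ℕ} {ag : Agent A d J} {L : ℝ}

lemma IsLinear.utility_zero (hl : ag.IsLinear) (a : A) {y : Outcome d}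
    (hy : (y : Fin d → ℝ) = 0) : ag.utility a y = 0 := by
  simpa using hl a 0 0 y y y (by simp [hy])

/-- `IsLinear` applies only to points of the cube. Keeping the scale `N` fixed, and not tied to `Q`,
keeps all partial sums inside it and lets the induction close. -/
lemma IsLinear.utility_smul_sum (hl : ag.IsLinear) (a : A) {N : ℝ} (hN : 0 < N)
    (y : ℕ → Outcome d) (Q : Finset ℕ) (hQ : (Q.card : ℝ) ≤ N) (m : Outcome d)
    (hm : (m : Fin d → ℝ) = N⁻¹ • ∑ t ∈ Q, (y t : Fin d → ℝ)) :
    ag.utility a m = N⁻¹ * ∑ t ∈ Q, ag.utility a (y t) := by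
  induction Q using Finset.induction_on generalizing m with
  | empty => simp [hl.utility_zero a (y := m) (by simpa using hm)]
  | insert s Q hs ih =>
    have hQ' : (Q.card : ℝ) ≤ N := by
      rw [Finset.card_insert_of_notMem hs] at hQ
      push_cast at hQ
      linarith
    have hmem : N⁻¹ • ∑ t ∈ Q, (y t : Fin d → ℝ) ∈ Set.Icc (0 : Fin d → ℝ) 1 := by
      constructor <;> intro i
      · simp only [Pi.zero_apply, Pi.smul_apply, Finset.sum_apply, smul_eq_mul]
        exact mul_nonneg (by positivity) (Finset.sum_nonneg fun t _ => (y t).2.1 i)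
      · simp only [Pi.one_apply, Pi.smul_apply, Finset.sum_apply, smul_eq_mul]
        rw [inv_mul_le_one₀ hN]
        refine le_trans (Finset.sum_le_card_nsmul _ _ 1 fun t _ => (y t).2.2 i) ?_
        simpa using hQ'
    rw [hl a 1 N⁻¹ ⟨_, hmem⟩ (y s) m (by rw [hm, Finset.sum_insert hs, smul_add, one_smul, add_comm]),
      ih hQ' ⟨_, hmem⟩ rfl, Finset.sum_insert hs]
    ring

/-- By linearity the two sums are `Q.card` times the utilities at the average prediction and the
average outcome; Lipschitz continuity is applied once, to these averages. -/
lemma abs_sum_utility_sub_le (hl : ag.IsLinear) (hL : ag.IsLipschitz L) (a : A)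
    (p y : ℕ → Outcome d) (Q : Finset ℕ) :
    |∑ t ∈ Q, (ag.utility a (p t) - ag.utility a (y t))| ≤
      L * ‖∑ t ∈ Q, ((p t : Fin d → ℝ) - (y t : Fin d → ℝ))‖ := by
  rcases Q.eq_empty_or_nonempty with rfl | hQ
  · simp
  have hN : (0 : ℝ) < Q.card := by exact_mod_cast hQ.card_pos
  have hmem (y : ℕ → Outcome d) :
      (Q.card : ℝ)⁻¹ • ∑ t ∈ Q, (y t : Fin d → ℝ) ∈ Set.Icc (0 : Fin d → ℝ) 1 := by
    constructor <;> intro i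
    · simp only [Pi.zero_apply, Pi.smul_apply, Finset.sum_apply, smul_eq_mul]
      exact mul_nonneg (by positivity) (Finset.sum_nonneg fun t _ => (y t).2.1 i)
    · simp only [Pi.one_apply, Pi.smul_apply, Finset.sum_apply, smul_eq_mul]
      rw [inv_mul_le_one₀ hN]
      refine le_trans (Finset.sum_le_card_nsmul _ _ 1 fun t _ => (y t).2.2 i) ?_
      simp
  have h := hL a ⟨_, hmem p⟩ ⟨_, hmem y⟩
  rw [hl.utility_smul_sum a hN p Q le_rfl _ rfl, hl.utility_smul_sum a hN y Q le_rfl _ rfl,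
    ← mul_sub, ← smul_sub, norm_smul, abs_mul, Real.norm_eq_abs, abs_of_pos (inv_pos.2 hN),
    ← mul_assoc, mul_comm L, mul_assoc] at h
  rw [Finset.sum_sub_distrib, Finset.sum_sub_distrib]
  exact le_of_mul_le_mul_left h (inv_pos.2 hN)

lemma IsLipschitz.nonneg [Nonempty A] (hL : ag.IsLipschitz L) (hd : 0 < d) : 0 ≤ L := by
  have : Nonempty (Fin d) := ⟨⟨0, hd⟩⟩
  have h := (abs_nonneg _).trans
    (hL (Classical.arbitrary A) ⟨1, zero_le_one, le_rfl⟩ ⟨0, le_rfl, zero_le_one⟩)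
  simpa using h

/-- Linearity forces the utility to vanish at the origin. This yields a trivial regret bound
proportional to `L`, which the bound by 1 on utilities would not give. -/
lemma utility_le_of_isLipschitz (hl : ag.IsLinear) (hL : ag.IsLipschitz L) (hL0 : 0 ≤ L) (a : A)
    (y : Outcome d) : ag.utility a y ≤ L := by
  have h := hL a y ⟨0, le_rfl, zero_le_one⟩
  rw [hl.utility_zero a (y := ⟨0, le_rfl, zero_le_one⟩) rfl, sub_zero, sub_zero] at h
  refine (le_abs_self _).trans (h.trans (mul_le_of_le_one_right hL0 ?_))
  rw [pi_norm_le_iff_of_nonneg zero_le_one]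
  intro i
  rw [Real.norm_of_nonneg (y.2.1 i)]
  exact y.2.2 i

lemma sum_utility_sub_le_card (hl : ag.IsLinear) (hL : ag.IsLipschitz L) (hL0 : 0 ≤ L)
    (R : Finset ℕ) (b act : ℕ → A) (y : ℕ → Outcome d) :
    ∑ t ∈ R, (ag.utility (b t) (y t) - ag.utility (act t) (y t)) ≤ L * R.card := by
  calc _ ≤ ∑ _t ∈ R, L := Finset.sum_le_sum fun t _ => by
        linarith [utility_le_of_isLipschitz hl hL hL0 (b t) (y t),
          (ag.utility_mem (act t) (y t)).1]
    _ = _ := by simp [mul_comm]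

/-- Swap regret is controlled by the biases on the rounds in which the actions are played. -/
lemma sum_swap_le [Fintype A] (hl : ag.IsLinear) (hL : ag.IsLipschitz L) {B : Set A}
    {R : Finset ℕ} {act : ℕ → A} {p y : ℕ → Outcome d}
    (hopt : ∀ t ∈ R, ∀ b ∈ B, ag.utility b (p t) ≤ ag.utility (act t) (p t)) (φ : A → B) :
    ∑ t ∈ R, (ag.utility (φ (act t)) (y t) - ag.utility (act t) (y t)) ≤
      ∑ a, 2 * (L * ‖∑ t ∈ roundsPlaying R act a,
        ((p t : Fin d → ℝ) - (y t : Fin d → ℝ))‖) := by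
  classical
  rw [← Finset.sum_fiberwise (s := R) (g := act)]
  refine Finset.sum_le_sum fun a _ => ?_
  have hR : R.filter (fun t => act t = a) = roundsPlaying R act a := by
    unfold roundsPlaying; congr
  rw [hR]
  set Q := roundsPlaying R act a
  have hQ (t) (ht : t ∈ Q) : t ∈ R ∧ act t = a := Finset.mem_filter.1 ht
  have h1 := (abs_le.1 (abs_sum_utility_sub_le hl hL (φ a : A) p y Q)).1
  have h2 := (abs_le.1 (abs_sum_utility_sub_le hl hL a p y Q)).2
  -- The added term `u(a, p t) - u(φ a, p t)` is nonnegative because `a` is the response to `p t`;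
  -- what remains is two prediction errors with a fixed action each.
  calc _ ≤ ∑ t ∈ Q, ((ag.utility a (p t) - ag.utility a (y t)) -
        (ag.utility (φ a) (p t) - ag.utility (φ a) (y t))) := by
        refine Finset.sum_le_sum fun t ht => ?_
        obtain ⟨htR, rfl⟩ := hQ t ht
        linarith [hopt t htR _ (φ (act t)).2]
    _ ≤ _ := by rw [Finset.sum_sub_distrib]; linarith

end Agent

/-- The numerical form of the regret bound. -/
lemma regret_bound {M T δ L s : ℝ} {K r : ℕ} (hM : 1 ≤ M) (hT : 1 ≤ T) (hδ : 0 < δ)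
    (hδ1 : δ < 1) (hL : 0 ≤ L) (hK : 1 ≤ K) (hs : s ≤ L * r)
    (h : s ≤ K * (2 * (L * (8 * (Real.log (M * T) + √(Real.log (M * T) * r)
      + √(Real.log (M / δ) * r)))))) :
    s ≤ 48 * (L * K * √(r * Real.log (M * T / δ))) := by
  have hr0 : (0 : ℝ) ≤ r := Nat.cast_nonneg r
  have hK1 : (1 : ℝ) ≤ K := by exact_mod_cast hK
  have hMT : M ≤ M * T := le_mul_of_one_le_right (by linarith) hT
  have hl0 : 0 ≤ Real.log (M * T) := Real.log_nonneg (hM.trans hMT)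
  have h1 : Real.log (M * T) ≤ Real.log (M * T / δ) := Real.log_le_log (by linarith) (by
    rw [le_div_iff₀ hδ]; nlinarith)
  have h2 : Real.log (M / δ) ≤ Real.log (M * T / δ) := Real.log_le_log (by positivity)
    (div_le_div_of_nonneg_right hMT hδ.le)
  set l := Real.log (M * T)
  set W := √(r * Real.log (M * T / δ)) with hW
  have hlW : √(l * r) ≤ W := Real.sqrt_le_sqrt (by nlinarith)
  have hDW : √(Real.log (M / δ) * r) ≤ W := Real.sqrt_le_sqrt (by nlinarith)
  have hW0 : 0 ≤ W := Real.sqrt_nonneg _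
  -- If `l ≤ r`, the additive `l` is at most `√(l r)` and three equal terms give `2 · 8 · 3 = 48`.
  -- Otherwise `r ≤ √(l r)` and the trivial bound `L r` is enough.
  rcases le_total l r with hlr | hlr
  · have : l ≤ √(l * r) := Real.le_sqrt_of_sq_le (by nlinarith)
    calc s ≤ _ := h
      _ ≤ K * (2 * (L * (8 * (W + W + W)))) := by gcongr; exact this.trans hlW
      _ = _ := by ring
  · have : (r : ℝ) ≤ √(l * r) := Real.le_sqrt_of_sq_le (by nlinarith)
    calc s ≤ L * r := hs
      _ ≤ L * W := mul_le_mul_of_nonneg_left (this.trans hlW) hL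
      _ ≤ L * W * (48 * K) := le_mul_of_one_le_right (mul_nonneg hL hW0) (by linarith)
      _ = _ := by ring

/-! ### The theorem -/

section Guarantees

variable {X A κ ι : Type*} [MeasurableSpace X] [Fintype A] [Fintype κ] {d J T : ℕ}

lemma card_triples [Fintype ι] :
    (Fintype.card ((κ × ι × A) × Fin d × ℤˣ) : ℝ) =
      2 * (d * Fintype.card A * Fintype.card ι * Fintype.card κ) := by
  simp only [Fintype.card_prod, Fintype.card_fin, Fintype.card_units_int]
  push_cast
  ring

omit [Fintype A] in
lemma card_roundsPlaying_le (R : Finset ℕ) (act : ℕ → A) (a : A) :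
    (roundsPlaying R act a).card ≤ R.card := by
  classical
  exact Finset.card_le_card (Finset.filter_subset _ _)

/-- A bound on the total wealth bounds the biases conditional on the decision events. -/
lemma norm_bias_le_of_totalWealth_le [Fintype ι] (agent : ι → Agent A d J)
    {h : κ → ℕ → X → Bool} (hev : IsMeasurableEvents (decisionEvent agent h)) (hT : 0 < T)
    {M δ : ℝ} (hM : 1 ≤ M) (hMT : 2 ≤ M * T) (hδ : 0 < δ) (hδ1 : δ < 1)
    (x : ℕ → X) (p y : ℕ → Outcome d)
    (hW : totalWealth (decisionEvent agent h) T T (transcript x p y T) ≤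
      Real.exp 1 * (2 * M * T) / δ) (i : ι) (S : κ) (a : A) :
    ‖∑ t ∈ roundsPlaying (rounds h T S x) ((agent i).played h x p y) a,
        ((p t : Fin d → ℝ) - (y t : Fin d → ℝ))‖ ≤
      8 * (Real.log (M * T)
        + √(Real.log (M * T) *
          ((roundsPlaying (rounds h T S x) ((agent i).played h x p y) a).card : ℝ))
        + √(Real.log (M / δ) * ((rounds h T S x).card : ℝ))) := by
  set R := rounds h T S x
  set act := (agent i).played h x p y
  set Q := roundsPlaying R act a
  set v := ∑ t ∈ Q, ((p t : Fin d → ℝ) - (y t : Fin d → ℝ)) with hv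
  have hQR : Q.card ≤ R.card := card_roundsPlaying_le R act a
  have hRT : R.card ≤ T :=
    (Finset.card_le_card (Finset.filter_subset _ _)).trans (Finset.card_range T).le
  set Λ := 1 + Real.log 2 + Real.log (M * T) + Real.log (1 / δ) with hΛ
  have hδlog : 0 ≤ Real.log (1 / δ) := Real.log_nonneg (by rw [le_div_iff₀ hδ]; linarith)
  have hMTlog : 0 ≤ Real.log (M * T) := Real.log_nonneg (by linarith)
  have hΛ1 : 1 < Λ := by linarith [Real.log_pos (one_lt_two (α := ℝ))]
  -- The Markov threshold, with `2M` triples and `T` rates, written as `exp Λ`.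
  have hexp : Real.exp 1 * (2 * M * T) / δ = Real.exp Λ := by
    rw [hΛ, Real.exp_add, Real.exp_add, Real.exp_add, Real.exp_log (by norm_num),
      Real.exp_log (by linarith), Real.exp_log (by positivity)]
    ring
  have key (k : Fin d) (σ : ℤˣ) : ((σ : ℤ) : ℝ) * v k ≤
      8 * (Real.log (M * T) + √(Real.log (M * T) * Q.card)
        + √(Real.log (M / δ) * R.card)) := by
    have hrate (j : ℕ) (hj : j < T) :
        rate j * (((σ : ℤ) : ℝ) * v k) - 2 * rate j ^ 2 * Q.card ≤ Λ := by
      have h1 := exp_le_wealth hev (rate_pos j).le (rate_le_half j) ((S, i, a), k, σ) x p y T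
      rw [sum_gain_decisionEvent, sum_decisionEvent] at h1
      have h2 : wealth (decisionEvent agent h) (rate j) ((S, i, a), k, σ) T
          (transcript x p y T) ≤ totalWealth (decisionEvent agent h) T T (transcript x p y T) := by
        have hpos (z) (j : ℕ) := (hev.wealth_pos (rate_pos j).le (rate_le_half j) z T
          (transcript x p y T)).le
        -- All wealths are positive, so each one is at most the total.
        refine le_trans ?_ (Finset.single_le_sum (fun z _ => Finset.sum_nonneg fun j _ => hpos z j)
          (Finset.mem_univ ((S, i, a), k, σ)))
        exact Finset.single_le_sum (f := fun j => wealth (decisionEvent agent h) (rate j)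
          ((S, i, a), k, σ) T (transcript x p y T)) (fun j _ => hpos _ j) (Finset.mem_range.2 hj)
      exact Real.exp_le_exp.1 (hexp ▸ h1.trans (h2.trans hW))
    refine bias_bound hM hMT hδ hδ1 hQR ?_ (le_of_forall_rate hT (hQR.trans hRT) hΛ1 hrate)
    rw [hv, Finset.sum_apply, Finset.mul_sum]
    refine (Finset.sum_le_card_nsmul _ _ 1 fun t _ => ?_).trans (by simp)
    refine (le_abs_self _).trans ?_
    rw [abs_mul, abs_units_cast, one_mul]
    exact (p t).abs_sub_le_one (y t) k
  rw [pi_norm_le_iff_of_nonneg (by positivity)]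
  intro k
  rw [Real.norm_eq_abs, abs_le']
  exact ⟨by simpa using key k 1, by simpa using key k (-1)⟩

omit [MeasurableSpace X] in
/-- Bias bounds on all actions bound the swap deviations of the elimination-based agent. -/
lemma sum_swap_le_of_norm_bias_le {ag : Agent A d J} {h : κ → ℕ → X → Bool} {M δ L : ℝ}
    (hd : 0 < d) (hA : 0 < Fintype.card A) (hT : 0 < T) (hM : 1 ≤ M) (hδ : 0 < δ) (hδ1 : δ < 1)
    (S : κ) (x : ℕ → X) (p y : ℕ → Outcome d)
    (hbias : ∀ a, ‖∑ t ∈ roundsPlaying (rounds h T S x) (ag.played h x p y) a,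
        ((p t : Fin d → ℝ) - (y t : Fin d → ℝ))‖ ≤
      8 * (Real.log (M * T)
        + √(Real.log (M * T) *
          ((roundsPlaying (rounds h T S x) (ag.played h x p y) a).card : ℝ))
        + √(Real.log (M / δ) * ((rounds h T S x).card : ℝ))))
    (hl : ag.IsLinear) (hL : ag.IsLipschitz L)
    (φ : A → ag.benchmark (rounds h T S x) y) :
    ∑ t ∈ rounds h T S x, (ag.utility (φ (ag.played h x p y t)) (y t) -
        ag.utility (ag.played h x p y t) (y t)) ≤
      48 * (L * Fintype.card A * √(((rounds h T S x).card : ℝ) * Real.log (M * T / δ))) := by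
  have : Nonempty A := Fintype.card_pos_iff.1 hA
  have hL0 := hL.nonneg hd
  have hT1 : (1 : ℝ) ≤ T := by exact_mod_cast hT
  have hlog : 0 ≤ Real.log (M * T) := Real.log_nonneg (by nlinarith)
  refine regret_bound hM hT1 hδ hδ1 hL0 hA
    (Agent.sum_utility_sub_le_card hl hL hL0 _ (fun t => φ (ag.played h x p y t)) _ y) ?_
  refine (Agent.sum_swap_le (p := p) hl hL
    (fun t ht b hb => ag.utility_le_utility_played h S x p y hb ht) φ).trans ?_
  refine (Finset.sum_le_card_nsmul _ _ _ fun a _ => ?_).trans (by rw [nsmul_eq_mul]; rfl)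
  have hc : ((roundsPlaying (rounds h T S x) (ag.played h x p y) a).card : ℝ) ≤
      (rounds h T S x).card := by exact_mod_cast card_roundsPlaying_le _ _ a
  refine mul_le_mul_of_nonneg_left (mul_le_mul_of_nonneg_left ((hbias a).trans ?_) hL0)
    zero_le_two
  gcongr

end Guarantees

theorem mainTheorem11 :
    ∃ C : ℝ, 0 < C ∧
      ∀ (X : Type*) [MeasurableSpace X] (A : Type*) [Fintype A] (ι : Type*) [Fintype ι]
        (κ : Type*) [Fintype κ] (d J T : ℕ) (agent : ι → Agent A d J) (h : κ → ℕ → X → Bool),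
        (∀ S t, Measurable (h S t)) →
        1 < d * Fintype.card A * Fintype.card ι * Fintype.card κ * T →
        ∃ q : WeightRule X d (κ × ι × A),
          (∀ ε : ℝ, 0 < ε → ∃ F : Forecaster X d,
            IsUnbiasedPrediction T (decisionEvent agent h) q ε F) ∧
          ∀ F : Forecaster X d, IsUnbiasedPrediction T (decisionEvent agent h) q (1 / T) F →
          ∀ (Ω : Type*) [MeasurableSpace Ω] (P : Measure Ω) [IsProbabilityMeasure P]
            (x : ℕ → Ω → X) (p y : ℕ → Ω → Outcome d), IsPlay F T P x p y →
          ∀ δ : ℝ, 0 < δ → δ < 1 →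
          ∃ G : Set Ω, MeasurableSet G ∧ ENNReal.ofReal (1 - δ) ≤ P G ∧
            ∀ ω ∈ G, ∀ (i : ι) (S : κ) (ps ys : ℕ → Outcome d) (act : ℕ → A) (R : Finset ℕ) (M : ℝ),
              (∀ t, ps t = p t ω) → (∀ t, ys t = y t ω) →
              act = (agent i).played h (fun t => x t ω) ps ys →
              R = rounds h T S (fun t => x t ω) →
              M = d * Fintype.card A * Fintype.card ι * Fintype.card κ →
              (∀ a : A,
                ‖∑ t ∈ roundsPlaying R act a, ((ps t : Fin d → ℝ) - (ys t : Fin d → ℝ))‖ ≤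
                  C * (Real.log (M * T)
                    + √(Real.log (M * T) * ((roundsPlaying R act a).card : ℝ))
                    + √(Real.log (M / δ) * (R.card : ℝ)))) ∧
              ∀ L : ℝ, (agent i).IsLinear → (agent i).IsLipschitz L →
                ((agent i).benchmark R ys).Nonempty →
                (agent i).swapRegret ((agent i).benchmark R ys) R act ys ≤
                    C * (L * Fintype.card A * √((R.card : ℝ) * Real.log (M * T / δ))) ∧
                (agent i).extRegret ((agent i).benchmark R ys) R act ys ≤
                    C * (L * Fintype.card A * √((R.card : ℝ) * Real.log (M * T / δ))) := by
  -- The regret bound needs 48; the bias bound needs only 8.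
  refine ⟨48, by norm_num, ?_⟩
  intro X _ A _ ι _ κ _ d J T agent h hh hcard
  have hne : d * Fintype.card A * Fintype.card ι * Fintype.card κ * T ≠ 0 := by omega
  simp only [mul_ne_zero_iff] at hne
  obtain ⟨⟨⟨⟨hd, hA⟩, hι⟩, hκ⟩, hT⟩ := hne
  have hT0 : 0 < T := Nat.pos_of_ne_zero hT
  have hM1 : (1 : ℝ) ≤ d * Fintype.card A * Fintype.card ι * Fintype.card κ := by
    have : 0 < d * Fintype.card A * Fintype.card ι * Fintype.card κ := by positivity
    exact_mod_cast this
  have hMT : (2 : ℝ) ≤ d * Fintype.card A * Fintype.card ι * Fintype.card κ * T := by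
    exact_mod_cast hcard
  have : Nonempty ((κ × ι × A) × Fin d × ℤˣ) := Fintype.card_pos_iff.1 (by
    simp only [Fintype.card_prod, Fintype.card_fin, Fintype.card_units_int]
    positivity)
  have hev := isMeasurableEvents_decisionEvent agent hh
  refine ⟨stakeWeights hev hT0,
    fun ε hε => exists_isUnbiasedPrediction_decisionEvent agent hh _ T hε, ?_⟩
  intro F hF Ω _ P _ x p y hplay δ hδ hδ1
  obtain ⟨G, hG, hPG, hbound⟩ := hplay.exists_totalWealth_le hev hT0 hF hδ
  refine ⟨G, hG, hPG, ?_⟩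
  rintro ω hω i S ps ys act R M hps hys rfl rfl rfl
  obtain rfl : ps = fun t => p t ω := funext hps
  obtain rfl : ys = fun t => y t ω := funext hys
  have hW := hbound ω hω
  rw [card_triples] at hW
  have hbias := norm_bias_le_of_totalWealth_le agent hev hT0 hM1 hMT hδ hδ1 (fun t => x t ω)
    (fun t => p t ω) (fun t => y t ω) hW i S
  have hlog := Real.log_nonneg (one_le_two.trans hMT)
  refine ⟨fun a => (hbias a).trans (mul_le_mul_of_nonneg_right (by norm_num) (by positivity)),
    fun L hl hL hB => ?_⟩
  have hswap := sum_swap_le_of_norm_bias_le (Nat.pos_of_ne_zero hd) (Nat.pos_of_ne_zero hA) hT0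
    hM1 hδ hδ1 S (fun t => x t ω) (fun t => p t ω) (fun t => y t ω) hbias hl hL
  have := hB.to_subtype
  -- External regret uses the constant swap `fun _ => a`.
  exact ⟨ciSup_le hswap, ciSup_le fun a => hswap fun _ => a⟩
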